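/- Let $d\ge 1$, $\mathbb{R}^d_+=\{x\in\mathbb{R}^d: x_d>0\}$, $0<s<1$, $p\ge 2$, $\alpha,\beta,\alpha+\beta\in(-1,sp)$ and $1+\alpha+\beta\neq sp$. Put $$\mathcal{D}=\frac{\pi^{\frac{d-1}{2}}\,\Gamma\left(\frac{1+sp}{2}\right)}{\Gamma\left(\frac{d+sp}{2}\right)}\int_0^1\frac{(t^\alpha+t^\beta)\left|1-t^{-\frac{1+\alpha+\beta-sp}{p}}\right|^p}{(1-t)^{1+sp}}\,dt,\qquad c_p=\min_{0<\tau<1/2}\left((1-\tau)^p-\tau^p+p\tau^{p-1}\right).$$ The minimum defining $c_p$ is attained, and $\mathcal{D}>0$. For every real-valued continuous function $u$ with compact support in $\mathbb{R}^d_+$, setting $v(x)=x_d^{\frac{1+\alpha+\beta-sp}{p}}u(x)$, the integral $\int_{\mathbb{R}^d_+}|u(x)|^p x_d^{-(sp-\alpha-\beta)}\,dx$ is finite and $$\int_{\mathbb{R}^d_+}\int_{\mathbb{R}^d_+}\frac{|u(x)-u(y)|^p}{|x-y|^{d+sp}}\,x_d^{\alpha}\,y_d^{\beta}\,dy\,dx-\mathcal{D}\int_{\mathbb{R}^d_+}\frac{|u(x)|^p}{x_d^{sp-\alpha-\beta}}\,dx\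 \ge\ c_p\int_{\mathbb{R}^d_+}\int_{\mathbb{R}^d_+}\frac{|v(x)-v(y)|^p}{|x-y|^{d+sp}}\,x_d^{-\frac{1-\alpha+\beta-sp}{2}}\,y_d^{-\frac{1+\alpha-\beta-sp}{2}}\,dy\,dx,$$ where the double integrals take values in $[0,\infty]$. For $p=2$ this is an equality, with $c_2=1$. -/

import Mathlib

open MeasureTheory

noncomputable section

/-- The `d`-dimensional Euclidean space for `d = n + 1`, so that every dimension `d ≥ 1` occurs. -/
abbrev Space (n : ℕ) : Type := EuclideanSpace ℝ (Fin (n + 1))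

/-- The last coordinate `x_d` of a point `x`. -/
def lastCoord {n : ℕ} (x : Space n) : ℝ := x (Fin.last n)

/-- The open half-space `{x : x_d > 0}`. -/
def halfSpace (n : ℕ) : Set (Space n) := {x | 0 < lastCoord x}

/-- Real continuous functions with compact support inside the open half-space
(functions on the half-space are extended by zero). -/
structure IsCcHalfSpace {n : ℕ} (u : Space n → ℝ) : Prop where
  continuous : Continuous u
  hasCompactSupport : HasCompactSupport u
  tsupport_subset : tsupport u ⊆ halfSpace n

/-- The weighted Gagliardo energy
`∫∫ |u(x) - u(y)|^p / |x - y|^(d + s p) * x_d^a * y_d^b dy dx` over the half-space,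
with values in `[0, ∞]`; here `d = n + 1`. -/
def gagliardoEnergy {n : ℕ} (s p a b : ℝ) (u : Space n → ℝ) : ENNReal :=
  ∫⁻ x in halfSpace n, ∫⁻ y in halfSpace n,
    ENNReal.ofReal (|u x - u y| ^ p / ‖x - y‖ ^ (((n + 1 : ℕ) : ℝ) + s * p)
      * lastCoord x ^ a * lastCoord y ^ b)

/-- The Hardy term `∫ |u(x)|^p / x_d^(s p - α - β) dx` over the half-space,
with values in `[0, ∞]`. -/
def hardyTerm {n : ℕ} (s p α β : ℝ) (u : Space n → ℝ) : ENNReal :=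
  ∫⁻ x in halfSpace n, ENNReal.ofReal (|u x| ^ p / lastCoord x ^ (s * p - α - β))

/-- The constant `𝒟(d, s, p, α, β)`. -/
def hardyConst (d : ℕ) (s p α β : ℝ) : ℝ :=
  Real.pi ^ (((d : ℝ) - 1) / 2) * Real.Gamma ((1 + s * p) / 2) / Real.Gamma ((d + s * p) / 2)
    * ∫ t in Set.Ioo (0 : ℝ) 1,
        (t ^ α + t ^ β) * |1 - t ^ (-((1 + α + β - s * p) / p))| ^ p / (1 - t) ^ (1 + s * p)

/-- The values `(1 - τ)^p - τ^p + p τ^(p-1)` for `0 < τ < 1/2`. -/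
def remainderValues (p : ℝ) : Set ℝ :=
  (fun τ : ℝ => (1 - τ) ^ p - τ ^ p + p * τ ^ (p - 1)) '' Set.Ioo 0 (1 / 2)

/-- The constant `c_p`, the infimum (in fact the minimum) of `remainderValues p`. -/
def remainderConst (p : ℝ) : ℝ := sInf (remainderValues p)

/-- The function `v(x) = x_d^((1 + α + β - s p)/p) u(x)`. -/
def groundTransform {n : ℕ} (s p α β : ℝ) (u : Space n → ℝ) (x : Space n) : ℝ :=
  lastCoord x ^ ((1 + α + β - s * p) / p) * u x

end

/-! The proof is a ground state substitution. Put g = (1+α+β-sp)/p and u = x_d^(-g) v, and let X, Y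
be the values of x_d^(-g) at two points, with Y < X. Everything rests on the pointwise bound |Xa -
Yb|^p ≥ (X-Y)^(p-1) (X|a|^p - Y|b|^p) + c_p (XY)^(p/2) |a-b|^p (`ground_state_inequality`), which
for p = 2 is an identity. Multiplied by the symmetrized kernel with a = v(x), b = v(y), its left
side gives the energy of u and its last term the remainder energy of v. The middle term integrates
to the Hardy term times 𝒟.

The pointwise bound says that t ↦ |A + t(B-A)|^p is uniformly convex, since a is the convex
combination of (Xa - Yb)/(X-Y) and b with weight Y/X on b. The convexity estimate
(`abs_rpow_uniform_convexity`) integrates the Bregman bound |A|^p - |m|^p - p|m|^(p-2) m (A-m) ≥ c_p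
|A-m|^p. At unit distance with m = -τ, the left side is the function whose minimum defines c_p.

For the middle term, integrating out the horizontal variables leaves a homogeneous kernel in the two
heights (`lintegral_lastCoord_mul_kernel`). Scaling by ρ = ht or ρ = h/t turns the X- and Y-parts
into the Hardy term times integrals over t of `ratioKernel` and t^(-g) `ratioKernel`
(`setLIntegral_potentialTerm`). These integrals differ by that of |1 - t^(-g)| `ratioKernel`, which
is the integrand of 𝒟.

Each part alone may diverge at t = 1. The argument is therefore run on the pairs with y_d < r x_d, r
< 1, where the smaller part is finite and can be cancelled (`hardy_remainder_pairCone`), and r → 1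
by monotone convergence. -/

/-! ### The constant c_p -/

/-- The tangent line inequality for the convex function `x ↦ x ^ q` on `[0, ∞)`. -/
theorem rpow_tangent_le {q x z : ℝ} (hq : 1 ≤ q) (hx : 0 ≤ x) (hz : 0 < z) :
    z ^ q + q * z ^ (q - 1) * (x - z) ≤ x ^ q := by
  have h := one_add_mul_self_le_rpow_one_add (s := x / z - 1)
    (by have : 0 ≤ x / z := by positivity
        linarith) hq
  have h1 : 1 + (x / z - 1) = x / z := by ring
  rw [h1, Real.div_rpow hx hz.le, le_div_iff₀ (by positivity)] at h
  have h2 : z ^ q = z ^ (q - 1) * z := by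
    rw [← Real.rpow_add_one hz.ne']; ring_nf
  calc z ^ q + q * z ^ (q - 1) * (x - z)
      = (1 + q * (x / z - 1)) * z ^ q := by rw [h2]; field_simp
    _ ≤ x ^ q := h

/-- The function whose minimum over `(0, 1/2)` is `remainderConst p`. -/
noncomputable def remainderFun (p τ : ℝ) : ℝ := (1 - τ) ^ p - τ ^ p + p * τ ^ (p - 1)

theorem remainderFun_two (τ : ℝ) : remainderFun 2 τ = 1 := by
  have : (2 : ℝ) - 1 = 1 := by norm_num
  simp only [remainderFun, this, Real.rpow_one, Real.rpow_two]
  ring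

theorem hasDerivAt_remainderFun {p : ℝ} (hp : 2 < p) (τ : ℝ) :
    HasDerivAt (remainderFun p)
      (-(p * (1 - τ) ^ (p - 1)) - p * τ ^ (p - 1) + p * ((p - 1) * τ ^ (p - 1 - 1))) τ := by
  have h1 : HasDerivAt (fun τ : ℝ => (1 - τ) ^ p) (p * (1 - τ) ^ (p - 1) * (-1)) τ := by
    have h0 : HasDerivAt (fun τ : ℝ => 1 - τ) (-1) τ := by
      simpa using (hasDerivAt_id τ).const_sub 1
    exact (Real.hasDerivAt_rpow_const (x := 1 - τ) (Or.inr (by linarith))).comp τ h0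
  have h2 : HasDerivAt (fun τ : ℝ => τ ^ p) (p * τ ^ (p - 1)) τ :=
    Real.hasDerivAt_rpow_const (Or.inr (by linarith))
  have h3 : HasDerivAt (fun τ : ℝ => τ ^ (p - 1)) ((p - 1) * τ ^ (p - 1 - 1)) τ :=
    Real.hasDerivAt_rpow_const (Or.inr (by linarith))
  exact ((h1.sub h2).add (h3.const_mul p)).congr_deriv (by ring)

/-- By compactness a minimum exists on the closed interval. For p > 2 the derivative is -p < 0 at 0
and 2p(p-2)(1/2)^(p-1) > 0 at 1/2, so neither endpoint is a minimizer. For p = 2 the function is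
constant. Comparison with the endpoints is kept because τ = 0 yields c_p ≤ 1. -/
theorem exists_isMinOn_remainderFun {p : ℝ} (hp : 2 ≤ p) :
    ∃ τ₀ ∈ Set.Ioo (0 : ℝ) (1 / 2), ∀ τ ∈ Set.Icc (0 : ℝ) (1 / 2),
      remainderFun p τ₀ ≤ remainderFun p τ := by
  rcases hp.eq_or_lt with rfl | hp
  · exact ⟨1 / 4, by norm_num, fun τ _ => by simp [remainderFun_two]⟩
  have hcont : ContinuousOn (remainderFun p) (Set.Icc 0 (1 / 2)) := fun τ _ =>
    (hasDerivAt_remainderFun hp τ).continuousAt.continuousWithinAt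
  obtain ⟨τ₀, h0, hmin⟩ := isCompact_Icc.exists_isMinOn
    (Set.nonempty_Icc.2 (by norm_num : (0 : ℝ) ≤ 1 / 2)) hcont
  refine ⟨τ₀, ⟨lt_of_le_of_ne h0.1 ?_, lt_of_le_of_ne h0.2 ?_⟩, fun τ hτ => hmin hτ⟩
  · rintro rfl
    have hd := hasDerivAt_iff_tendsto_slope.1 (hasDerivAt_remainderFun hp 0)
    have hneg : -(p * (1 - 0) ^ (p - 1)) - p * 0 ^ (p - 1) + p * ((p - 1) * 0 ^ (p - 1 - 1))
        < (0 : ℝ) := by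
      rw [Real.zero_rpow (by linarith : p - 1 ≠ 0), Real.zero_rpow (by linarith : p - 1 - 1 ≠ 0)]
      simp; linarith
    have hev := (hd.mono_left (nhdsWithin_mono 0 (fun x (hx : x ∈ Set.Ioi (0 : ℝ)) => hx.ne'))).eventually
      (gt_mem_nhds hneg)
    obtain ⟨τ, hτ, hτ2⟩ := (hev.and (Ioo_mem_nhdsGT (by norm_num : (0 : ℝ) < 1 / 2))).exists
    have h1 : remainderFun p 0 ≤ remainderFun p τ := hmin ⟨hτ2.1.le, hτ2.2.le⟩
    rw [slope_def_field, div_neg_iff] at hτ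
    rcases hτ with h | h <;> linarith [hτ2.1]
  · rintro rfl
    have hd := hasDerivAt_iff_tendsto_slope.1 (hasDerivAt_remainderFun hp (1 / 2))
    have hpos : (0 : ℝ) < -(p * (1 - 1 / 2) ^ (p - 1)) - p * (1 / 2) ^ (p - 1)
        + p * ((p - 1) * (1 / 2) ^ (p - 1 - 1)) := by
      have h2 : (1 / 2 : ℝ) ^ (p - 1 - 1) = 2 * (1 / 2 : ℝ) ^ (p - 1) := by
        rw [Real.rpow_sub_one (by norm_num)]; ring
      have h3 : (1 - 1 / 2 : ℝ) = 1 / 2 := by norm_num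
      rw [h2, h3]
      have h4 : (0 : ℝ) < (1 / 2 : ℝ) ^ (p - 1) := by positivity
      have : 0 < 2 * p * (p - 2) * (1 / 2 : ℝ) ^ (p - 1) := by
        have : 0 < p - 2 := by linarith
        positivity
      nlinarith
    have hev := (hd.mono_left (nhdsWithin_mono (1 / 2)
      (fun x (hx : x ∈ Set.Iio (1 / 2 : ℝ)) => ne_of_lt hx))).eventually (lt_mem_nhds hpos)
    obtain ⟨τ, hτ, hτ2⟩ := (hev.and (Ioo_mem_nhdsLT (by norm_num : (0 : ℝ) < 1 / 2))).exists
    have h1 : remainderFun p (1 / 2) ≤ remainderFun p τ := hmin ⟨hτ2.1.le, hτ2.2.le⟩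
    rw [slope_def_field, div_pos_iff] at hτ
    rcases hτ with h | h <;> linarith [hτ2.2]

theorem isLeast_remainderConst {p : ℝ} (hp : 2 ≤ p) :
    IsLeast (remainderValues p) (remainderConst p) := by
  obtain ⟨τ₀, h0, hmin⟩ := exists_isMinOn_remainderFun hp
  have h : IsLeast (remainderValues p) (remainderFun p τ₀) := by
    refine ⟨⟨τ₀, h0, rfl⟩, ?_⟩
    rintro _ ⟨τ, hτ, rfl⟩
    exact hmin τ ⟨hτ.1.le, hτ.2.le⟩
  rw [remainderConst, h.csInf_eq]
  exact h

theorem remainderConst_le {p : ℝ} (hp : 2 ≤ p) {τ : ℝ} (hτ : τ ∈ Set.Icc (0 : ℝ) (1 / 2)) :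
    remainderConst p ≤ remainderFun p τ := by
  obtain ⟨τ₀, h0, hmin⟩ := exists_isMinOn_remainderFun hp
  exact ((isLeast_remainderConst hp).2 ⟨τ₀, h0, rfl⟩).trans (hmin τ hτ)

theorem remainderConst_two : remainderConst 2 = 1 := by
  obtain ⟨τ, -, h⟩ := (isLeast_remainderConst le_rfl).1
  rw [← h]
  exact remainderFun_two τ

theorem remainderConst_pos {p : ℝ} (hp : 2 ≤ p) : 0 < remainderConst p := by
  obtain ⟨τ, hτ, h⟩ := (isLeast_remainderConst hp).1
  rw [← h]
  have h1 : τ ^ p < (1 - τ) ^ p :=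
    Real.rpow_lt_rpow hτ.1.le (by linarith [hτ.2]) (by linarith)
  have h2 : 0 < p * τ ^ (p - 1) := mul_pos (by linarith) (Real.rpow_pos_of_pos hτ.1 _)
  simp only
  linarith

theorem remainderConst_le_one {p : ℝ} (hp : 2 ≤ p) : remainderConst p ≤ 1 := by
  have h := remainderConst_le hp (τ := 0) (by norm_num)
  rwa [remainderFun, Real.zero_rpow (by linarith), Real.zero_rpow (by linarith), sub_zero,
    sub_zero, Real.one_rpow, mul_zero, add_zero] at h

/-! ### Bregman divergence of |x|^p -/

/-- The right side equals 1 at x = 0 and is nondecreasing, because its derivative is p times the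
tangent line gap of y^(p-1) between y and y + 1. -/
theorem one_le_rpow_bregman {p x : ℝ} (hp : 2 ≤ p) (hx : 0 ≤ x) :
    1 ≤ (x + 1) ^ p - x ^ p - p * x ^ (p - 1) := by
  have hd : ∀ y : ℝ, HasDerivAt (fun y : ℝ => (y + 1) ^ p - y ^ p - p * y ^ (p - 1))
      (p * (y + 1) ^ (p - 1) - p * y ^ (p - 1) - p * ((p - 1) * y ^ (p - 1 - 1))) y := by
    intro y
    have h1 : HasDerivAt (fun y : ℝ => (y + 1) ^ p) (p * (y + 1) ^ (p - 1)) y := by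
      have := (Real.hasDerivAt_rpow_const (x := y + 1) (p := p) (Or.inr (by linarith))).comp y
        ((hasDerivAt_id y).add_const 1)
      rwa [mul_one] at this
    exact (h1.sub (Real.hasDerivAt_rpow_const (Or.inr (by linarith)))).sub
      ((Real.hasDerivAt_rpow_const (Or.inr (by linarith))).const_mul p)
  have hmono : MonotoneOn (fun y : ℝ => (y + 1) ^ p - y ^ p - p * y ^ (p - 1)) (Set.Ici 0) := by
    refine monotoneOn_of_deriv_nonneg (convex_Ici 0)
      (fun y _ => (hd y).continuousAt.continuousWithinAt)
      (fun y _ => (hd y).differentiableAt.differentiableWithinAt) fun y hy => ?_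
    rw [interior_Ici] at hy
    rw [(hd y).deriv]
    have := rpow_tangent_le (q := p - 1) (x := y + 1) (z := y) (by linarith)
      (by linarith [Set.mem_Ioi.1 hy]) hy
    have h3 : 0 ≤ p * ((y + 1) ^ (p - 1) - (y ^ (p - 1) + (p - 1) * y ^ (p - 1 - 1) * (y + 1 - y))) :=
      mul_nonneg (by linarith) (by linarith)
    nlinarith
  have h := hmono (Set.mem_Ici.2 le_rfl) hx hx
  simpa [Real.zero_rpow (by linarith : p ≠ 0), Real.zero_rpow (by linarith : p - 1 ≠ 0)] using h

/-- Same monotonicity argument, with the tangent taken at y + 1; the value at x = 0 is p - 1 ≥ 1. -/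
theorem one_le_rpow_bregman_left {p x : ℝ} (hp : 2 ≤ p) (hx : 0 ≤ x) :
    1 ≤ x ^ p - (x + 1) ^ p + p * (x + 1) ^ (p - 1) := by
  have hd : ∀ y : ℝ, 0 ≤ y → HasDerivAt (fun y : ℝ => y ^ p - (y + 1) ^ p + p * (y + 1) ^ (p - 1))
      (p * y ^ (p - 1) - p * (y + 1) ^ (p - 1) + p * ((p - 1) * (y + 1) ^ (p - 1 - 1))) y := by
    intro y hy
    have h1 : ∀ q : ℝ, HasDerivAt (fun y : ℝ => (y + 1) ^ q) (q * (y + 1) ^ (q - 1)) y := by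
      intro q
      have := (Real.hasDerivAt_rpow_const (x := y + 1) (p := q) (Or.inl (by linarith))).comp y
        ((hasDerivAt_id y).add_const 1)
      rwa [mul_one] at this
    exact ((Real.hasDerivAt_rpow_const (Or.inr (by linarith))).sub (h1 p)).add
      ((h1 (p - 1)).const_mul p)
  have hmono : MonotoneOn (fun y : ℝ => y ^ p - (y + 1) ^ p + p * (y + 1) ^ (p - 1))
      (Set.Ici 0) := by
    refine monotoneOn_of_deriv_nonneg (convex_Ici 0)
      (fun y hy => (hd y hy).continuousAt.continuousWithinAt)
      (fun y hy => (hd y (interior_subset hy)).differentiableAt.differentiableWithinAt)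
      fun y hy => ?_
    rw [(hd y (interior_subset hy)).deriv]
    rw [interior_Ici] at hy
    have hy' : 0 < y := hy
    have := rpow_tangent_le (q := p - 1) (x := y) (z := y + 1) (by linarith) hy'.le (by linarith)
    have h3 : 0 ≤ p * (y ^ (p - 1) -
        ((y + 1) ^ (p - 1) + (p - 1) * (y + 1) ^ (p - 1 - 1) * (y - (y + 1)))) :=
      mul_nonneg (by linarith) (by linarith)
    nlinarith
  have h := hmono (Set.mem_Ici.2 le_rfl) hx hx
  simp only [zero_add, Real.one_rpow, Real.zero_rpow (by linarith : p ≠ 0)] at h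
  linarith

/-- With r = 1 - τ, homogenizing by τ + r = 1 turns the difference of the two sides into (p-2)(τ^p -
r^p) + pτr(τ^(p-2) - r^(p-2)), a sum of nonnegative terms. Hence the minimum over (0, 1/2) bounds
the function on all of [0, 1]. -/
theorem remainderFun_one_sub_le {p τ : ℝ} (hp : 2 ≤ p) (h1 : 1 / 2 ≤ τ) (h2 : τ ≤ 1) :
    remainderFun p (1 - τ) ≤ remainderFun p τ := by
  have hτ : 0 < τ := by linarith
  rcases h2.eq_or_lt with rfl | h2
  · simp only [remainderFun, sub_self, sub_zero, Real.one_rpow,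
      Real.zero_rpow (by linarith : p ≠ 0), Real.zero_rpow (by linarith : p - 1 ≠ 0)]
    linarith
  have hr : 0 < 1 - τ := by linarith
  have e1 : ∀ z : ℝ, 0 < z → z ^ p = z ^ (p - 2) * z * z := by
    intro z hz
    rw [← Real.rpow_add_one hz.ne', ← Real.rpow_add_one hz.ne']; ring_nf
  have e2 : ∀ z : ℝ, 0 < z → z ^ (p - 1) = z ^ (p - 2) * z := by
    intro z hz
    rw [← Real.rpow_add_one hz.ne']; ring_nf
  have hm : (1 - τ) ^ (p - 2) ≤ τ ^ (p - 2) :=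
    Real.rpow_le_rpow hr.le (by linarith) (by linarith)
  have hm1 : 0 < (1 - τ) ^ (p - 2) := by positivity
  simp only [remainderFun, sub_sub_cancel, e1 _ hτ, e1 _ hr, e2 _ hτ, e2 _ hr]
  set r := 1 - τ with hr'
  have hτr : τ = 1 - r := by linarith
  set P := τ ^ (p - 2)
  set R := r ^ (p - 2)
  have k1 : 0 ≤ (p - 2) * (P * (τ * τ) - R * (r * r)) := by
    apply mul_nonneg (by linarith)
    have : r * r ≤ τ * τ := by nlinarith
    nlinarith [mul_le_mul hm this (by positivity) (by positivity)]
  have k2 : 0 ≤ p * (τ * r) * (P - R) := by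
    apply mul_nonneg (by positivity) (by linarith)
  have k3 : (r * (R * 1)) = r * R * (τ + r) := by rw [hτr]; ring
  have k4 : (τ * (P * 1)) = τ * P * (τ + r) := by rw [hτr]; ring
  nlinarith

/-- The sharp lower bound for the Bregman divergence of `|x| ^ p` at unit distance. -/
theorem remainderConst_le_abs_rpow_bregman_unit {p : ℝ} (hp : 2 ≤ p) (m : ℝ) :
    remainderConst p ≤ |m + 1| ^ p - |m| ^ p - p * |m| ^ (p - 2) * m := by
  -- Only -1 ≤ m < 0 meets the function defining c_p; for m ≥ 0 and m < -1 the divergence is at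
  -- least 1 ≥ c_p.
  rcases le_or_gt 0 m with hm | hm
  · have e : |m| ^ (p - 2) * m = m ^ (p - 1) := by
      rcases hm.eq_or_lt with rfl | hm
      · rw [mul_zero, Real.zero_rpow (by linarith)]
      · rw [abs_of_pos hm, ← Real.rpow_add_one hm.ne']; ring_nf
    rw [mul_assoc, e, abs_of_nonneg hm, abs_of_nonneg (by linarith)]
    exact (remainderConst_le_one hp).trans (one_le_rpow_bregman hp hm)
  · obtain ⟨τ, rfl⟩ : ∃ τ, m = -τ := ⟨-m, by ring⟩
    have hτ : 0 < τ := by linarith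
    have e : |-τ| ^ (p - 2) * (-τ) = -τ ^ (p - 1) := by
      rw [abs_neg, abs_of_pos hτ, mul_neg, ← Real.rpow_add_one hτ.ne']; ring_nf
    rw [mul_assoc, e, abs_neg, abs_of_pos hτ]
    rcases le_or_gt τ 1 with h1 | h1
    · have e2 : |-τ + 1| = 1 - τ := by rw [abs_of_nonneg (by linarith)]; ring
      rw [e2]
      have : remainderConst p ≤ remainderFun p τ := by
        rcases le_or_gt τ (1 / 2) with h2 | h2
        · exact remainderConst_le hp ⟨hτ.le, h2⟩
        · exact (remainderConst_le hp ⟨by linarith, by linarith⟩).trans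
            (remainderFun_one_sub_le hp h2.le h1)
      rw [remainderFun] at this
      linarith
    · have e2 : |-τ + 1| = τ - 1 := by rw [abs_of_nonpos (by linarith)]; ring
      rw [e2]
      have := one_le_rpow_bregman_left (p := p) (x := τ - 1) hp (by linarith)
      rw [sub_add_cancel] at this
      linarith [remainderConst_le_one hp]

/-- Both sides are p-homogeneous in (A, m), also under a change of sign, so dividing by A - m
reduces to unit distance. -/
theorem remainderConst_mul_le_abs_rpow_bregman {p : ℝ} (hp : 2 ≤ p) (A m : ℝ) :
    remainderConst p * |A - m| ^ p ≤ |A| ^ p - |m| ^ p - p * |m| ^ (p - 2) * m * (A - m) := by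
  rcases eq_or_ne A m with rfl | hA
  · simp [Real.zero_rpow (by linarith : p ≠ 0)]
  have hl : A - m ≠ 0 := sub_ne_zero.2 hA
  set l := A - m with hldef
  have hl' : 0 < |l| := abs_pos.2 hl
  have h := remainderConst_le_abs_rpow_bregman_unit hp (m / l)
  have e1 : m / l + 1 = A / l := by field_simp; linarith
  have e2 : |l| ^ p = |l| ^ (p - 2) * (l * l) := by
    rw [← abs_mul_abs_self l, ← mul_assoc, ← Real.rpow_add_one hl'.ne',
      ← Real.rpow_add_one hl'.ne']
    ring_nf
  rw [e1, abs_div, abs_div, Real.div_rpow (abs_nonneg _) hl'.le,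
    Real.div_rpow (abs_nonneg _) hl'.le, Real.div_rpow (abs_nonneg _) hl'.le] at h
  have hpos : 0 < |l| ^ p := by positivity
  have hpos2 : 0 < |l| ^ (p - 2) := by positivity
  calc remainderConst p * |l| ^ p
      ≤ (|A| ^ p / |l| ^ p - |m| ^ p / |l| ^ p - p * (|m| ^ (p - 2) / |l| ^ (p - 2)) * (m / l))
        * |l| ^ p := mul_le_mul_of_nonneg_right h hpos.le
    _ = |A| ^ p - |m| ^ p - p * |m| ^ (p - 2) * m * l := by
      rw [sub_mul, sub_mul, div_mul_cancel₀ _ hpos.ne', div_mul_cancel₀ _ hpos.ne', e2]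
      field_simp

/-! ### Uniform convexity and the pointwise ground state inequality -/

/-- The difference of the sides vanishes at t = 1 and decreases in t: up to a positive factor, minus
its derivative is the Bernoulli gap of y^((q+1)/2) at 1. -/
theorem sub_one_mul_rpow_le {q t : ℝ} (hq : 1 ≤ q) (ht : 0 < t) (ht1 : t ≤ 1) :
    q * (1 - t) * t ^ ((q - 1) / 2) ≤ 1 - t ^ q := by
  have hd : ∀ s : ℝ, 0 < s → HasDerivAt (fun s : ℝ => 1 - s ^ q - q * (1 - s) * s ^ ((q - 1) / 2))
      (-(q * s ^ (q - 1)) - (q * (-1) * s ^ ((q - 1) / 2)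
        + q * (1 - s) * ((q - 1) / 2 * s ^ ((q - 1) / 2 - 1)))) s := by
    intro s hs
    have h1 : HasDerivAt (fun s : ℝ => 1 - s) (-1) s := by
      simpa using (hasDerivAt_id s).const_sub 1
    exact ((Real.hasDerivAt_rpow_const (Or.inl hs.ne')).const_sub 1).sub
      ((h1.const_mul q).mul (Real.hasDerivAt_rpow_const (Or.inl hs.ne')))
  have hanti : AntitoneOn (fun s : ℝ => 1 - s ^ q - q * (1 - s) * s ^ ((q - 1) / 2))
      (Set.Icc t 1) := by
    refine antitoneOn_of_deriv_nonpos (convex_Icc t 1)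
      (fun y hy => (hd y (ht.trans_le hy.1)).continuousAt.continuousWithinAt)
      (fun y hy => (hd y (ht.trans_le
        (interior_subset hy).1)).differentiableAt.differentiableWithinAt)
      fun y hy => ?_
    have hy' := interior_subset hy
    have hy0 : 0 < y := ht.trans_le hy'.1
    rw [(hd y hy0).deriv]
    have h := rpow_tangent_le (q := (q + 1) / 2) (x := y) (z := 1) (by linarith) hy0.le one_pos
    simp only [Real.one_rpow, mul_one] at h
    have e1 : y ^ (q - 1) = y ^ ((q - 1) / 2 - 1) * y ^ ((q + 1) / 2) := by
      rw [← Real.rpow_add hy0]; ring_nf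
    have e2 : y ^ ((q - 1) / 2) = y ^ ((q - 1) / 2 - 1) * y := by
      rw [← Real.rpow_add_one hy0.ne']; ring_nf
    rw [e1, e2]
    set Y := y ^ ((q - 1) / 2 - 1)
    have hY : 0 < Y := by positivity
    have : 0 ≤ q * Y * (y ^ ((q + 1) / 2) - (1 + (q + 1) / 2 * (y - 1))) :=
      mul_nonneg (by positivity) (by linarith)
    nlinarith
  have h := hanti ⟨le_rfl, ht1⟩ ⟨ht1, le_rfl⟩ ht1
  simp only [Real.one_rpow, sub_self, mul_zero, zero_mul] at h
  linarith

/-- A weighted uniform convexity estimate for `|x| ^ p`. -/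
theorem abs_rpow_uniform_convexity {p t : ℝ} (hp : 2 ≤ p) (ht : 0 < t) (ht1 : t ≤ 1) (A B : ℝ) :
    |A + t * (B - A)| ^ p + remainderConst p * ((1 - t) * t ^ (p / 2)) * |B - A| ^ p
      ≤ (1 - t) * |A| ^ p + t * |B| ^ p := by
  set K := remainderConst p * |B - A| ^ p with hK
  have hK0 : 0 ≤ K := mul_nonneg (remainderConst_pos hp).le (by positivity)
  -- With m = A + s(B-A), the derivative of the quotient is -1/s² times the Bregman divergence of A
  -- from m. That divergence is at least K s^p, so the added power K s^(p-1)/(p-1) still leaves a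
  -- decreasing function.
  have hd : ∀ s : ℝ, 0 < s → HasDerivAt
      (fun s : ℝ => ((1 - s) * |A| ^ p - |A + s * (B - A)| ^ p) / s + K / (p - 1) * s ^ (p - 1))
      (((-1 * |A| ^ p - p * |A + s * (B - A)| ^ (p - 2) * (A + s * (B - A)) * (B - A)) * s
        - ((1 - s) * |A| ^ p - |A + s * (B - A)| ^ p) * 1) / s ^ 2
        + K / (p - 1) * ((p - 1) * s ^ (p - 1 - 1))) s := by
    intro s hs
    have h1 : HasDerivAt (fun s : ℝ => 1 - s) (-1) s := by
      simpa using (hasDerivAt_id s).const_sub 1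
    have h2 : HasDerivAt (fun s : ℝ => A + s * (B - A)) (B - A) s := by
      simpa using ((hasDerivAt_id s).mul_const (B - A)).const_add A
    have h3 := (hasDerivAt_abs_rpow (A + s * (B - A)) (p := p) (by linarith)).comp s h2
    exact (((h1.mul_const _).sub h3).div (hasDerivAt_id s) hs.ne').add
      ((Real.hasDerivAt_rpow_const (Or.inl hs.ne')).const_mul _)
  have hanti : AntitoneOn (fun s : ℝ => ((1 - s) * |A| ^ p - |A + s * (B - A)| ^ p) / s
      + K / (p - 1) * s ^ (p - 1)) (Set.Icc t 1) := by
    refine antitoneOn_of_deriv_nonpos (convex_Icc t 1)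
      (fun y hy => (hd y (ht.trans_le hy.1)).continuousAt.continuousWithinAt)
      (fun y hy => (hd y (ht.trans_le
        (interior_subset hy).1)).differentiableAt.differentiableWithinAt)
      fun s hs => ?_
    have hs0 : 0 < s := ht.trans_le (interior_subset hs).1
    rw [(hd s hs0).deriv]
    have h := remainderConst_mul_le_abs_rpow_bregman hp A (A + s * (B - A))
    have e1 : A - (A + s * (B - A)) = -(s * (B - A)) := by ring
    rw [e1, abs_neg, abs_mul, abs_of_pos hs0, Real.mul_rpow hs0.le (abs_nonneg _)] at h
    have e2 : s ^ p = s ^ (p - 1 - 1) * s ^ 2 := by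
      rw [← Real.rpow_add_natCast hs0.ne']; congr 1; push_cast; ring
    rw [e2] at h
    have hp1 : p - 1 ≠ 0 := by linarith
    have e3 : K / (p - 1) * ((p - 1) * s ^ (p - 1 - 1)) = K * s ^ (p - 1 - 1) * s ^ 2 / s ^ 2 := by
      field_simp
    rw [e3, ← add_div]
    apply div_nonpos_of_nonpos_of_nonneg _ (by positivity)
    have e4 : K * s ^ (p - 1 - 1) * s ^ 2 =
        remainderConst p * (s ^ (p - 1 - 1) * s ^ 2 * |B - A| ^ p) := by rw [hK]; ring
    rw [e4]
    linarith
  have h := hanti ⟨le_rfl, ht1⟩ ⟨ht1, le_rfl⟩ ht1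
  simp only [Real.one_rpow, sub_self, zero_mul, one_mul, add_sub_cancel, div_one, mul_one] at h
  -- Comparing s = t with s = 1 gives the gain t K (1 - t^(p-1))/(p-1); this trades it for the form
  -- K (1-t) t^(p/2), whose factor t^(p/2) becomes the product (XY)^(p/2).
  have h2 := sub_one_mul_rpow_le (q := p - 1) (by linarith) ht ht1
  have e5 : t ^ (p / 2) = t * t ^ ((p - 1 - 1) / 2) := by
    rw [mul_comm, ← Real.rpow_add_one ht.ne']; ring_nf
  have hp1 : 0 < p - 1 := by linarith
  have h3 : K * ((1 - t) * t ^ ((p - 1 - 1) / 2)) ≤ K / (p - 1) * (1 - t ^ (p - 1)) := by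
    rw [div_mul_eq_mul_div, le_div_iff₀ hp1]
    nlinarith [mul_le_mul_of_nonneg_left h2 hK0]
  have h4 : K * ((1 - t) * t ^ ((p - 1 - 1) / 2)) ≤
      ((1 - t) * |A| ^ p - |A + t * (B - A)| ^ p) / t + |B| ^ p := by linarith
  have h5 := mul_le_mul_of_nonneg_right h4 ht.le
  rw [add_mul, div_mul_cancel₀ _ ht.ne'] at h5
  rw [e5]
  nlinarith

/-- The pointwise ground state inequality. -/
theorem ground_state_inequality {p X Y : ℝ} (hp : 2 ≤ p) (hY : 0 < Y) (hXY : Y < X) (a b : ℝ) :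
    (X - Y) ^ (p - 1) * (X * |a| ^ p) + remainderConst p * ((X * Y) ^ (p / 2) * |a - b| ^ p)
      ≤ |X * a - Y * b| ^ p + (X - Y) ^ (p - 1) * (Y * |b| ^ p) := by
  have hX : 0 < X := hY.trans hXY
  have hd : 0 < X - Y := by linarith
  -- These endpoints are chosen so that the intermediate point is a and the first endpoint carries
  -- Xa - Yb.
  have h := abs_rpow_uniform_convexity hp (t := Y / X) (by positivity)
    ((div_le_one hX).2 hXY.le) ((X * a - Y * b) / (X - Y)) b
  have e1 : (X * a - Y * b) / (X - Y) + Y / X * (b - (X * a - Y * b) / (X - Y)) = a := by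
    field_simp; ring
  have e2 : b - (X * a - Y * b) / (X - Y) = -(X * (a - b) / (X - Y)) := by
    field_simp; ring
  rw [e1, e2, abs_neg, abs_div, abs_div, abs_mul, abs_of_pos hX, abs_of_pos hd,
    Real.div_rpow (abs_nonneg _) hd.le, Real.div_rpow (by positivity) hd.le,
    Real.mul_rpow hX.le (abs_nonneg _), Real.div_rpow hY.le hX.le] at h
  have e3 : X ^ p = X ^ (p / 2) * X ^ (p / 2) := by rw [← Real.rpow_add hX]; ring_nf
  have e4 : (X - Y) ^ p = (X - Y) ^ (p - 1) * (X - Y) := by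
    rw [← Real.rpow_add_one hd.ne']; ring_nf
  rw [Real.mul_rpow hX.le hY.le]
  have e5 : 1 - Y / X = (X - Y) / X := by field_simp
  rw [e5, e3, e4] at h
  have hXp : 0 < X ^ (p / 2) := by positivity
  have hdp : 0 < (X - Y) ^ (p - 1) := by positivity
  have h2 := mul_le_mul_of_nonneg_left h (by positivity : 0 ≤ (X - Y) ^ (p - 1) * X)
  calc _ = _ := ?_
    _ ≤ _ := h2
    _ = _ := ?_
  · field_simp
  · field_simp

theorem ground_state_identity (X Y a b : ℝ) :
    (X - Y) ^ ((2 : ℝ) - 1) * (X * |a| ^ (2 : ℝ)) + 1 * ((X * Y) ^ ((2 : ℝ) / 2) * |a - b| ^ (2 : ℝ))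
      = |X * a - Y * b| ^ (2 : ℝ) + (X - Y) ^ ((2 : ℝ) - 1) * (Y * |b| ^ (2 : ℝ)) := by
  have e1 : (2 : ℝ) - 1 = 1 := by norm_num
  have e2 : (2 : ℝ) / 2 = 1 := by norm_num
  simp only [e1, e2, Real.rpow_one, Real.rpow_two, sq_abs]
  ring

/-! ### Integrating out the horizontal variables -/

/-- A nonzero Bochner integral certifies integrability, since the integral of a nonintegrable
function is 0 by convention. Closed formulas for integrals thus transfer to [0, ∞] with no separate
integrability proof. -/
theorem lintegral_ofReal_of_integral_pos {X : Type*} [MeasurableSpace X] {μ : Measure X}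
    {f : X → ℝ} (hf : 0 ≤ᵐ[μ] f) (hpos : 0 < ∫ x, f x ∂μ) :
    ∫⁻ x, ENNReal.ofReal (f x) ∂μ = ENNReal.ofReal (∫ x, f x ∂μ) := by
  have hi : Integrable f μ := by
    by_contra h
    rw [integral_undef h] at hpos
    exact lt_irrefl _ hpos
  exact (ofReal_integral_eq_lintegral_ofReal hi hf).symm

theorem lintegral_exp_neg_mul_sq_norm (n : ℕ) {b : ℝ} (hb : 0 < b) :
    ∫⁻ z : EuclideanSpace ℝ (Fin n), ENNReal.ofReal (Real.exp (-b * ‖z‖ ^ 2))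
      = ENNReal.ofReal ((Real.pi / b) ^ ((n : ℝ) / 2)) := by
  have h := GaussianFourier.integral_rexp_neg_mul_sq_norm (V := EuclideanSpace ℝ (Fin n)) hb
  rw [finrank_euclideanSpace_fin] at h
  rw [← h]
  refine lintegral_ofReal_of_integral_pos (Filter.Eventually.of_forall fun _ => by positivity) ?_
  rw [h]
  have := Real.pi_pos
  positivity

theorem lintegral_rpow_mul_exp_neg_mul {a r : ℝ} (ha : 0 < a) (hr : 0 < r) :
    ∫⁻ t in Set.Ioi (0 : ℝ), ENNReal.ofReal (t ^ (a - 1) * Real.exp (-(r * t)))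
      = ENNReal.ofReal ((1 / r) ^ a * Real.Gamma a) := by
  have h := Real.integral_rpow_mul_exp_neg_mul_Ioi ha hr
  rw [← h]
  refine lintegral_ofReal_of_integral_pos ?_ ?_
  · filter_upwards [ae_restrict_mem measurableSet_Ioi] with t ht
    have : 0 < t := ht
    simp only [Pi.zero_apply]
    positivity
  · rw [h]
    have := Real.Gamma_pos_of_pos ha
    positivity

/-- The constant produced by integrating out the horizontal variables. -/
noncomputable def sliceConst (n : ℕ) (q : ℝ) : ℝ :=
  Real.pi ^ ((n : ℝ) / 2) * Real.Gamma ((1 + q) / 2) / Real.Gamma (((n : ℝ) + 1 + q) / 2)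

theorem sliceConst_pos (n : ℕ) {q : ℝ} (hq : 0 < q) : 0 < sliceConst n q := by
  have h1 : 0 < Real.Gamma ((1 + q) / 2) := Real.Gamma_pos_of_pos (by positivity)
  have h2 : 0 < Real.Gamma (((n : ℝ) + 1 + q) / 2) := Real.Gamma_pos_of_pos (by positivity)
  have := Real.pi_pos
  unfold sliceConst
  positivity

/-- Write Γ(Q) a^(-Q) as the integral of t^(Q-1) e^(-at) and exchange the integrals. The Gaussian
integral in z contributes t^(-n/2), leaving a Gamma integral with parameter Q - n/2 = (1+q)/2. -/
theorem lintegral_one_div_norm_sq_add_rpow (n : ℕ) {q h : ℝ} (hq : 0 < q) (hh : 0 < h) :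
    ∫⁻ z : EuclideanSpace ℝ (Fin n),
        ENNReal.ofReal ((1 / (‖z‖ ^ 2 + h ^ 2)) ^ (((n : ℝ) + 1 + q) / 2))
      = ENNReal.ofReal (sliceConst n q) * ENNReal.ofReal (1 / h ^ (1 + q)) := by
  set Q : ℝ := ((n : ℝ) + 1 + q) / 2 with hQ
  have hQ0 : 0 < Q := by positivity
  have hG : 0 < Real.Gamma Q := Real.Gamma_pos_of_pos hQ0
  have hG1 : 0 < Real.Gamma ((1 + q) / 2) := Real.Gamma_pos_of_pos (by positivity)
  have hpi := Real.pi_pos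
  have key : ENNReal.ofReal (Real.Gamma Q) * ∫⁻ z : EuclideanSpace ℝ (Fin n),
      ENNReal.ofReal ((1 / (‖z‖ ^ 2 + h ^ 2)) ^ Q)
      = ENNReal.ofReal (Real.pi ^ ((n : ℝ) / 2) *
          ((1 / h ^ 2) ^ ((1 + q) / 2) * Real.Gamma ((1 + q) / 2))) := by
    calc _ = ∫⁻ z : EuclideanSpace ℝ (Fin n), ∫⁻ t in Set.Ioi (0 : ℝ),
          ENNReal.ofReal (t ^ (Q - 1) * Real.exp (-((‖z‖ ^ 2 + h ^ 2) * t))) := by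
          rw [← lintegral_const_mul' _ _ ENNReal.ofReal_ne_top]
          refine lintegral_congr fun z => ?_
          rw [lintegral_rpow_mul_exp_neg_mul hQ0 (by positivity),
            ← ENNReal.ofReal_mul hG.le, mul_comm]
      _ = ∫⁻ t in Set.Ioi (0 : ℝ), ∫⁻ z : EuclideanSpace ℝ (Fin n),
          ENNReal.ofReal (t ^ (Q - 1) * Real.exp (-((‖z‖ ^ 2 + h ^ 2) * t))) := by
          rw [lintegral_lintegral_swap]
          refine Measurable.aemeasurable ?_
          fun_prop
      _ = ∫⁻ t in Set.Ioi (0 : ℝ), ENNReal.ofReal (Real.pi ^ ((n : ℝ) / 2)) *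
          ENNReal.ofReal (t ^ ((1 + q) / 2 - 1) * Real.exp (-(h ^ 2 * t))) := by
          refine setLIntegral_congr_fun measurableSet_Ioi fun t ht => ?_
          have ht : 0 < t := ht
          have e : ∀ z : EuclideanSpace ℝ (Fin n),
              ENNReal.ofReal (t ^ (Q - 1) * Real.exp (-((‖z‖ ^ 2 + h ^ 2) * t)))
              = ENNReal.ofReal (t ^ (Q - 1) * Real.exp (-(h ^ 2 * t)))
                * ENNReal.ofReal (Real.exp (-t * ‖z‖ ^ 2)) := by
            intro z
            rw [← ENNReal.ofReal_mul (by positivity), mul_assoc, ← Real.exp_add]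
            ring_nf
          simp only [e]
          rw [lintegral_const_mul' _ _ ENNReal.ofReal_ne_top, lintegral_exp_neg_mul_sq_norm n ht,
            ← ENNReal.ofReal_mul (by positivity), ← ENNReal.ofReal_mul (by positivity)]
          congr 1
          rw [Real.div_rpow hpi.le ht.le]
          have e2 : t ^ (Q - 1) = t ^ ((1 + q) / 2 - 1) * t ^ ((n : ℝ) / 2) := by
            rw [← Real.rpow_add ht]; congr 1; rw [hQ]; ring
          rw [e2]
          field_simp
      _ = _ := by
          rw [lintegral_const_mul' _ _ ENNReal.ofReal_ne_top,
            lintegral_rpow_mul_exp_neg_mul (by positivity) (by positivity),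
            ← ENNReal.ofReal_mul (by positivity)]
  have e3 : Real.pi ^ ((n : ℝ) / 2) * ((1 / h ^ 2) ^ ((1 + q) / 2) * Real.Gamma ((1 + q) / 2))
      = Real.Gamma Q * (sliceConst n q * (1 / h ^ (1 + q))) := by
    have e4 : (1 / h ^ 2) ^ ((1 + q) / 2) = 1 / h ^ (1 + q) := by
      rw [Real.div_rpow zero_le_one (by positivity), Real.one_rpow, ← Real.rpow_natCast,
        ← Real.rpow_mul hh.le]
      congr 2; push_cast; ring
    rw [e4, sliceConst, ← hQ]
    field_simp
  rw [e3, ENNReal.ofReal_mul hG.le] at key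
  rw [← ENNReal.ofReal_mul (sliceConst_pos n hq).le]
  exact (ENNReal.mul_right_inj (ENNReal.ofReal_pos.2 hG).ne' ENNReal.ofReal_ne_top).1 key

/-- The point of `Space n` with last coordinate `ρ` and remaining coordinates `z`. -/
noncomputable def attachLast (n : ℕ) : ℝ × EuclideanSpace ℝ (Fin n) ≃ᵐ Space n :=
  ((MeasurableEquiv.refl ℝ).prodCongr (MeasurableEquiv.toLp 2 (Fin n → ℝ)).symm).trans
    ((MeasurableEquiv.piFinSuccAbove (fun _ : Fin (n + 1) => ℝ) (Fin.last n)).symm.trans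
      (MeasurableEquiv.toLp 2 (Fin (n + 1) → ℝ)))

theorem measurePreserving_attachLast (n : ℕ) : MeasurePreserving (attachLast n) := by
  have h1 : MeasurePreserving
      ((MeasurableEquiv.refl ℝ).prodCongr (MeasurableEquiv.toLp 2 (Fin n → ℝ)).symm) :=
    (MeasurePreserving.id (volume : Measure ℝ)).prod
      (EuclideanSpace.volume_preserving_symm_measurableEquiv_toLp (Fin n))
  have h2 := (volume_preserving_piFinSuccAbove (fun _ : Fin (n + 1) => ℝ) (Fin.last n)).symm
  have h3 := (EuclideanSpace.volume_preserving_symm_measurableEquiv_toLp (Fin (n + 1))).symm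
  exact (h3.comp h2).comp h1

theorem attachLast_apply {n : ℕ} (w : ℝ × EuclideanSpace ℝ (Fin n)) :
    attachLast n w
      = WithLp.toLp 2 ((Fin.last n).insertNth (α := fun _ => ℝ) w.1 (fun i => w.2 i)) := rfl

theorem lastCoord_attachLast {n : ℕ} (w : ℝ × EuclideanSpace ℝ (Fin n)) :
    lastCoord (attachLast n w) = w.1 := by
  simp [lastCoord, attachLast_apply]

theorem norm_sub_attachLast_sq {n : ℕ} (x : Space n) (w : ℝ × EuclideanSpace ℝ (Fin n)) :
    ‖x - attachLast n w‖ ^ 2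
      = ‖w.2 - WithLp.toLp 2 (fun i : Fin n => x i.castSucc)‖ ^ 2 + |lastCoord x - w.1| ^ 2 := by
  rw [EuclideanSpace.norm_sq_eq, EuclideanSpace.norm_sq_eq, Fin.sum_univ_castSucc]
  congr 1
  · refine Finset.sum_congr rfl fun i _ => ?_
    rw [← norm_neg]
    simp [attachLast_apply]
  · simp [lastCoord, attachLast_apply]

@[fun_prop]
theorem measurable_lastCoord {n : ℕ} : Measurable (lastCoord : Space n → ℝ) := by
  unfold lastCoord; fun_prop

/-- Integrating out the horizontal variables against the kernel `|x - y| ^ (-(d + q))`. -/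
theorem lintegral_lastCoord_mul_kernel {n : ℕ} {q : ℝ} (hq : 0 < q) (x : Space n)
    {G : ℝ → ENNReal} (hG : Measurable G) (hGx : G (lastCoord x) = 0) :
    ∫⁻ y : Space n, G (lastCoord y) * ENNReal.ofReal (1 / ‖x - y‖ ^ (((n + 1 : ℕ) : ℝ) + q))
      = ENNReal.ofReal (sliceConst n q) *
        ∫⁻ ρ : ℝ, G ρ * ENNReal.ofReal (1 / |lastCoord x - ρ| ^ (1 + q)) := by
  have hm : Measurable fun y : Space n =>
      G (lastCoord y) * ENNReal.ofReal (1 / ‖x - y‖ ^ (((n + 1 : ℕ) : ℝ) + q)) := by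
    fun_prop
  rw [← (measurePreserving_attachLast n).lintegral_comp hm, Measure.volume_eq_prod,
    lintegral_prod _ ?_,
    ← lintegral_const_mul' _ _ ENNReal.ofReal_ne_top]
  swap
  · exact (hm.comp (attachLast n).measurable).aemeasurable
  refine lintegral_congr fun ρ => ?_
  simp only [lastCoord_attachLast]
  have hm2 : Measurable fun z : EuclideanSpace ℝ (Fin n) =>
      ENNReal.ofReal (1 / ‖x - attachLast n (ρ, z)‖ ^ (((n + 1 : ℕ) : ℝ) + q)) := by
    have := (attachLast n).measurable.comp (measurable_prodMk_left (x := ρ))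
    have h2 : Measurable fun z => attachLast n (ρ, z) := this
    fun_prop
  rw [lintegral_const_mul _ hm2]
  -- On the slice through x the formula with h > 0 is unavailable; the vanishing of `G` there
  -- removes it.
  by_cases hρ : ρ = lastCoord x
  · rw [hρ, hGx]; simp
  have hh : 0 < |lastCoord x - ρ| := abs_pos.2 (sub_ne_zero.2 (Ne.symm hρ))
  have e : ∀ z : EuclideanSpace ℝ (Fin n),
      ENNReal.ofReal (1 / ‖x - attachLast n (ρ, z)‖ ^ (((n + 1 : ℕ) : ℝ) + q))
      = ENNReal.ofReal ((1 / (‖z - WithLp.toLp 2 (fun i : Fin n => x i.castSucc)‖ ^ 2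
          + |lastCoord x - ρ| ^ 2)) ^ (((n : ℝ) + 1 + q) / 2)) := by
    intro z
    rw [← norm_sub_attachLast_sq x (ρ, z), Real.div_rpow zero_le_one (by positivity),
      Real.one_rpow, ← Real.rpow_natCast, ← Real.rpow_mul (norm_nonneg _)]
    congr 3; push_cast; ring
  simp only [e]
  rw [lintegral_sub_right_eq_self (fun z : EuclideanSpace ℝ (Fin n) => ENNReal.ofReal
      ((1 / (‖z‖ ^ 2 + |lastCoord x - ρ| ^ 2)) ^ (((n : ℝ) + 1 + q) / 2))),
    lintegral_one_div_norm_sq_add_rpow n hq hh]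
  ring

/-! ### The one-dimensional kernel and its scaling -/

theorem setLIntegral_Ioo_comp_mul {h : ℝ} (hh : 0 < h) (r : ℝ) (Φ : ℝ → ENNReal) :
    ∫⁻ ρ in Set.Ioo 0 (r * h), Φ ρ = ∫⁻ t in Set.Ioo 0 r, ENNReal.ofReal h * Φ (h * t) := by
  have himg : (fun t : ℝ => h * t) '' Set.Ioo 0 r = Set.Ioo 0 (r * h) := by
    rw [Set.image_mul_left_Ioo hh, mul_zero, mul_comm]
  rw [← himg, lintegral_image_eq_lintegral_deriv_mul_of_monotoneOn (f' := fun _ => h)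
    measurableSet_Ioo]
  · intro t _
    simpa using ((hasDerivAt_id t).const_mul h).hasDerivWithinAt
  · exact fun a _ b _ hab => mul_le_mul_of_nonneg_left hab hh.le

/-- The reciprocal substitution brings heights above h to the same parameter interval as heights
below h, so that the two contributions can be compared in t. -/
theorem setLIntegral_Ioi_comp_div {h r : ℝ} (hh : 0 < h) (hr : 0 < r) (Φ : ℝ → ENNReal) :
    ∫⁻ ρ in Set.Ioi (h / r), Φ ρ
      = ∫⁻ t in Set.Ioo 0 r, ENNReal.ofReal (h / t ^ 2) * Φ (h / t) := by
  have himg : (fun t : ℝ => h / t) '' Set.Ioo 0 r = Set.Ioi (h / r) := by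
    ext ρ
    constructor
    · rintro ⟨t, ht, rfl⟩
      exact div_lt_div_of_pos_left hh ht.1 ht.2
    · intro hρ
      have hρ' : h / r < ρ := hρ
      have h0 : 0 < ρ := (div_pos hh hr).trans hρ'
      exact ⟨h / ρ, ⟨by positivity, (div_lt_comm₀ hr h0).1 hρ'⟩, by field_simp⟩
  rw [← himg, lintegral_image_eq_lintegral_deriv_mul_of_antitoneOn
    (f' := fun t => -(h / t ^ 2)) measurableSet_Ioo]
  · simp
  · intro t ht
    have := ((hasDerivAt_inv ht.1.ne').const_mul h).hasDerivWithinAt (s := Set.Ioo 0 r)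
    refine (this.congr_deriv ?_).congr (fun x _ => ?_) ?_
    · ring
    · rw [div_eq_mul_inv]
    · rw [div_eq_mul_inv]
  · exact fun a ha b _ hab => div_le_div_of_nonneg_left hh.le ha.1 hab

/-- The one-dimensional kernel obtained from the ground state `h ↦ h ^ (-g)`. -/
noncomputable def lineKernel (p α β q g h ρ : ℝ) : ℝ :=
  |h ^ (-g) - ρ ^ (-g)| ^ (p - 1) * (h ^ α * ρ ^ β + h ^ β * ρ ^ α) * (1 / |h - ρ| ^ (1 + q))

theorem lineKernel_comm (p α β q g h ρ : ℝ) :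
    lineKernel p α β q g h ρ = lineKernel p α β q g ρ h := by
  unfold lineKernel
  rw [abs_sub_comm, abs_sub_comm h ρ]
  ring

/-- The value of `lineKernel` at the pair `(1, t)`, for `0 < t < 1`. -/
noncomputable def ratioKernel (p α β q g t : ℝ) : ℝ :=
  |1 - t ^ (-g)| ^ (p - 1) * (t ^ α + t ^ β) / (1 - t) ^ (1 + q)

/-- The integrand of the Hardy constant. -/
noncomputable def hardyIntegrand (p α β q g t : ℝ) : ℝ :=
  (t ^ α + t ^ β) * |1 - t ^ (-g)| ^ p / (1 - t) ^ (1 + q)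

theorem lineKernel_mul (p α β q g : ℝ) {h t : ℝ} (hh : 0 < h) (ht : t ∈ Set.Ioo (0 : ℝ) 1) :
    h * lineKernel p α β q g h (h * t)
      = h ^ (α + β - q - g * (p - 1)) * ratioKernel p α β q g t := by
  have ht0 := ht.1
  have ht1 : 0 < 1 - t := by linarith [ht.2]
  have e1 : h ^ (-g) - (h * t) ^ (-g) = h ^ (-g) * (1 - t ^ (-g)) := by
    rw [Real.mul_rpow hh.le ht0.le]; ring
  have e2 : h - h * t = h * (1 - t) := by ring
  have e3 : h ^ (α + β - q - g * (p - 1)) = h * (h ^ (-g * (p - 1)) * (h ^ α * h ^ β) *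
      (h ^ (1 + q))⁻¹) := by
    rw [← Real.rpow_neg hh.le, ← Real.rpow_add hh, ← Real.rpow_add hh, ← Real.rpow_add hh]
    nth_rw 2 [← Real.rpow_one h]
    rw [← Real.rpow_add hh]
    ring_nf
  unfold lineKernel ratioKernel
  rw [e1, e2, abs_mul, abs_mul, abs_of_pos hh, abs_of_pos ht1, abs_of_pos (by positivity),
    Real.mul_rpow (by positivity) (abs_nonneg _), Real.mul_rpow hh.le ht1.le,
    ← Real.rpow_mul hh.le, e3, Real.mul_rpow hh.le ht0.le, Real.mul_rpow hh.le ht0.le]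
  field_simp
  ring

/-- By symmetry this is `lineKernel_mul` at base height h/t. The relation on g makes the homogeneity
exponent g - 1, and the leftover powers of t combine to t^(-g). -/
theorem lineKernel_div {p α β q g : ℝ} (hg : g * p = 1 + α + β - q) {h t : ℝ} (hh : 0 < h)
    (ht : t ∈ Set.Ioo (0 : ℝ) 1) :
    h / t ^ 2 * lineKernel p α β q g h (h / t)
      = h ^ (α + β - q - g * (p - 1)) * (t ^ (-g) * ratioKernel p α β q g t) := by
  have ht0 := ht.1
  have h1 := lineKernel_mul p α β q g (div_pos hh ht0) ht
  rw [div_mul_cancel₀ _ ht0.ne', lineKernel_comm, Real.div_rpow hh.le ht0.le] at h1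
  have e : t ^ (-g) = (t ^ (α + β - q - g * (p - 1)))⁻¹ * t⁻¹ := by
    rw [← Real.rpow_neg ht0.le]
    rw [← Real.rpow_neg_one t, ← Real.rpow_add ht0]
    congr 1; linarith
  calc h / t ^ 2 * lineKernel p α β q g h (h / t)
      = h / t * lineKernel p α β q g h (h / t) / t := by field_simp
    _ = _ := by rw [h1, e]; field_simp

theorem ratioKernel_nonneg (p α β q g : ℝ) {t : ℝ} (ht : t ∈ Set.Ioo (0 : ℝ) 1) :
    0 ≤ ratioKernel p α β q g t := by
  have ht0 := ht.1
  have ht1 : 0 < 1 - t := by linarith [ht.2]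
  unfold ratioKernel
  positivity

theorem setLIntegral_lineKernel_Ioo (p α β q g : ℝ) {h r : ℝ} (hh : 0 < h) (hr : r ≤ 1) :
    ∫⁻ ρ in Set.Ioo 0 (r * h), ENNReal.ofReal (lineKernel p α β q g h ρ)
      = ENNReal.ofReal (h ^ (α + β - q - g * (p - 1))) *
        ∫⁻ t in Set.Ioo 0 r, ENNReal.ofReal (ratioKernel p α β q g t) := by
  rw [setLIntegral_Ioo_comp_mul hh, ← lintegral_const_mul' _ _ ENNReal.ofReal_ne_top]
  refine setLIntegral_congr_fun measurableSet_Ioo fun t ht => ?_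
  rw [← ENNReal.ofReal_mul hh.le, lineKernel_mul _ _ _ _ _ hh ⟨ht.1, ht.2.trans_le hr⟩,
    ENNReal.ofReal_mul (by positivity)]

theorem setLIntegral_lineKernel_Ioi {p α β q g : ℝ} (hg : g * p = 1 + α + β - q) {h r : ℝ}
    (hh : 0 < h) (hr0 : 0 < r) (hr : r ≤ 1) :
    ∫⁻ ρ in Set.Ioi (h / r), ENNReal.ofReal (lineKernel p α β q g h ρ)
      = ENNReal.ofReal (h ^ (α + β - q - g * (p - 1))) *
        ∫⁻ t in Set.Ioo 0 r, ENNReal.ofReal (t ^ (-g) * ratioKernel p α β q g t) := by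
  rw [setLIntegral_Ioi_comp_div hh hr0, ← lintegral_const_mul' _ _ ENNReal.ofReal_ne_top]
  refine setLIntegral_congr_fun measurableSet_Ioo fun t ht => ?_
  have ht0 := ht.1
  rw [← ENNReal.ofReal_mul (by positivity), lineKernel_div hg hh ⟨ht.1, ht.2.trans_le hr⟩,
    ENNReal.ofReal_mul (by positivity)]

@[fun_prop]
theorem measurable_ratioKernel (p α β q g : ℝ) : Measurable (ratioKernel p α β q g) := by
  unfold ratioKernel; fun_prop

@[fun_prop]
theorem measurable_hardyIntegrand (p α β q g : ℝ) : Measurable (hardyIntegrand p α β q g) := by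
  unfold hardyIntegrand; fun_prop

theorem hardyIntegrand_nonneg (p α β q g : ℝ) {t : ℝ} (ht : t ∈ Set.Ioo (0 : ℝ) 1) :
    0 ≤ hardyIntegrand p α β q g t := by
  have ht0 := ht.1
  have ht1 : 0 < 1 - t := by linarith [ht.2]
  unfold hardyIntegrand
  positivity

theorem hardyIntegrand_pos (p α β q : ℝ) {g t : ℝ} (hg : g ≠ 0) (ht : t ∈ Set.Ioo (0 : ℝ) 1) :
    0 < hardyIntegrand p α β q g t := by
  have ht0 := ht.1
  have ht1 : 0 < 1 - t := by linarith [ht.2]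
  have h1 : t ^ (-g) ≠ 1 := by
    intro h
    have h3 := congrArg Real.log h
    rw [Real.log_rpow ht0, Real.log_one, neg_mul, neg_eq_zero] at h3
    exact mul_ne_zero hg (Real.log_neg ht0 ht.2).ne h3
  have h2 : 0 < |1 - t ^ (-g)| := abs_pos.2 (sub_ne_zero.2 h1.symm)
  unfold hardyIntegrand
  positivity

theorem abs_rpow_eq_mul_rpow_sub_one {z p : ℝ} (hp : 1 < p) : |z| ^ p = |z| * |z| ^ (p - 1) := by
  rcases eq_or_ne z 0 with rfl | hz
  · simp [Real.zero_rpow (by linarith : p ≠ 0)]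
  · rw [mul_comm, ← Real.rpow_add_one (abs_pos.2 hz).ne']; ring_nf

theorem hardyIntegrand_eq {p : ℝ} (hp : 1 < p) (α β q g t : ℝ) :
    hardyIntegrand p α β q g t = |1 - t ^ (-g)| * ratioKernel p α β q g t := by
  unfold hardyIntegrand ratioKernel
  rw [abs_rpow_eq_mul_rpow_sub_one hp]
  ring

/-- For g < 0 one has t^(-g) ≤ 1, so the absolute value in the Hardy integrand opens as 1 - t^(-g).
The identity is kept additive because either integral may be infinite; for g > 0 the two roles are
exchanged. -/
theorem lintegral_ratioKernel_of_neg {p g r : ℝ} (hp : 1 < p) (α β q : ℝ) (hg : g < 0)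
    (hr : r ≤ 1) :
    ∫⁻ t in Set.Ioo 0 r, ENNReal.ofReal (ratioKernel p α β q g t)
      = (∫⁻ t in Set.Ioo 0 r, ENNReal.ofReal (t ^ (-g) * ratioKernel p α β q g t))
        + ∫⁻ t in Set.Ioo 0 r, ENNReal.ofReal (hardyIntegrand p α β q g t) := by
  rw [← lintegral_add_left (by fun_prop)]
  refine setLIntegral_congr_fun measurableSet_Ioo fun t ht => ?_
  have ht' : t ∈ Set.Ioo (0 : ℝ) 1 := ⟨ht.1, ht.2.trans_le hr⟩
  have h0 := ratioKernel_nonneg p α β q g ht'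
  rw [← ENNReal.ofReal_add (mul_nonneg (Real.rpow_nonneg ht.1.le _) h0)
    (hardyIntegrand_nonneg p α β q g ht'), hardyIntegrand_eq hp, abs_of_nonneg]
  · congr 1; ring
  · exact sub_nonneg.2 (Real.rpow_le_one ht.1.le ht'.2.le (by linarith))

theorem lintegral_ratioKernel_of_pos {p g r : ℝ} (hp : 1 < p) (α β q : ℝ) (hg : 0 < g)
    (hr : r ≤ 1) :
    ∫⁻ t in Set.Ioo 0 r, ENNReal.ofReal (t ^ (-g) * ratioKernel p α β q g t)
      = (∫⁻ t in Set.Ioo 0 r, ENNReal.ofReal (ratioKernel p α β q g t))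
        + ∫⁻ t in Set.Ioo 0 r, ENNReal.ofReal (hardyIntegrand p α β q g t) := by
  rw [← lintegral_add_left (by fun_prop)]
  refine setLIntegral_congr_fun measurableSet_Ioo fun t ht => ?_
  have ht' : t ∈ Set.Ioo (0 : ℝ) 1 := ⟨ht.1, ht.2.trans_le hr⟩
  have h0 := ratioKernel_nonneg p α β q g ht'
  rw [← ENNReal.ofReal_add h0 (hardyIntegrand_nonneg p α β q g ht'), hardyIntegrand_eq hp,
    abs_of_nonpos]
  · congr 1; ring
  · exact sub_nonpos.2 (Real.one_le_rpow_of_pos_of_le_one_of_nonpos ht.1 ht'.2.le (by linarith))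

/-! ### Finiteness of the truncated potentials and positivity of 𝒟 -/

/-- The exponents produced by t^(-gp) are q - 1 - β and q - 1 - α, which exceed -1 exactly because
α, β < q. This function majorizes all the kernels near t = 0. -/
theorem integrableOn_rpow_sum {p α β q g : ℝ} (hg : g * p = 1 + α + β - q)
    (hα : α ∈ Set.Ioo (-1) q) (hβ : β ∈ Set.Ioo (-1) q) :
    IntegrableOn (fun t : ℝ => (1 + t ^ (-g * p)) * (t ^ α + t ^ β)) (Set.Ioo 0 1) := by
  have hi : ∀ e : ℝ, -1 < e → IntegrableOn (fun t : ℝ => t ^ e) (Set.Ioo 0 1) := fun e he =>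
    (intervalIntegral.integrableOn_Ioo_rpow_iff one_pos).2 he
  have h := ((hi α hα.1).add (hi β hβ.1)).add
    ((hi (-g * p + α) (by linarith [hβ.2])).add (hi (-g * p + β) (by linarith [hα.2])))
  refine IntegrableOn.congr_fun h (fun t ht => ?_) measurableSet_Ioo
  simp only [Pi.add_apply, Real.rpow_add ht.1]
  ring

theorem abs_one_sub_rpow_le {z e : ℝ} (hz : 0 ≤ z) (he : 0 ≤ e) : |1 - z| ^ e ≤ 1 + z ^ e := by
  have h0 : 0 ≤ z ^ e := Real.rpow_nonneg hz e
  rcases le_total z 1 with h | h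
  · have : |1 - z| ^ e ≤ 1 := by
      rw [abs_of_nonneg (by linarith)]
      exact Real.rpow_le_one (by linarith) (by linarith) he
    linarith
  · have : |1 - z| ^ e ≤ z ^ e := by
      rw [abs_of_nonpos (by linarith)]
      exact Real.rpow_le_rpow (by linarith) (by linarith) he
    linarith

theorem one_div_rpow_one_sub_le {q r t : ℝ} (hq : 0 < q) (ht : t < r) (hr : r < 1) :
    1 / (1 - t) ^ (1 + q) ≤ 1 / (1 - r) ^ (1 + q) := by
  have h1 : 0 < 1 - r := by linarith
  exact one_div_le_one_div_of_le (by positivity)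
    (Real.rpow_le_rpow h1.le (by linarith) (by linarith))

theorem setLIntegral_ofReal_lt_top_of_le {f F : ℝ → ℝ} {s : Set ℝ} (hs : MeasurableSet s)
    (hF : IntegrableOn F s) (h : ∀ t ∈ s, f t ≤ F t) :
    ∫⁻ t in s, ENNReal.ofReal (f t) < ⊤ :=
  (setLIntegral_mono' hs fun t ht => ENNReal.ofReal_le_ofReal
    ((h t ht).trans (le_abs_self _))).trans_lt (by
      simpa [← Real.norm_eq_abs, ofReal_norm, HasFiniteIntegral] using hF.hasFiniteIntegral)

/-- Only the smaller of the two potentials has to be finite for the cancellation, and for g < 0 it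
is this one. The bound r < 1 keeps away from t = 1, where the kernel is of order (1-t)^(p-2-q). -/
theorem lintegral_mul_ratioKernel_lt_top {p α β q g r : ℝ} (hp : 1 < p) (hq : 0 < q)
    (hgp : g * p = 1 + α + β - q) (hα : α ∈ Set.Ioo (-1) q) (hβ : β ∈ Set.Ioo (-1) q)
    (hg : g < 0) (hr : r < 1) :
    ∫⁻ t in Set.Ioo 0 r, ENNReal.ofReal (t ^ (-g) * ratioKernel p α β q g t) < ⊤ := by
  refine setLIntegral_ofReal_lt_top_of_le measurableSet_Ioo
    (((integrableOn_rpow_sum hgp hα hβ).mono_set (Set.Ioo_subset_Ioo_right hr.le)).mul_const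
      (1 / (1 - r) ^ (1 + q))) fun t ht => ?_
  have ht0 := ht.1
  have h1 : 0 < 1 - t := by linarith [ht.2]
  have h2 : t ^ (-g) ≤ 1 := Real.rpow_le_one ht0.le (by linarith) (by linarith)
  have h3 : 0 ≤ t ^ (-g) := by positivity
  have h4 : |1 - t ^ (-g)| ^ (p - 1) ≤ 1 := by
    rw [abs_of_nonneg (by linarith)]
    exact Real.rpow_le_one (by linarith) (by linarith) (by linarith)
  have h5 := one_div_rpow_one_sub_le hq ht.2 hr
  have h6 : t ^ (-g) * |1 - t ^ (-g)| ^ (p - 1) ≤ 1 + t ^ (-g * p) := by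
    have : t ^ (-g) * |1 - t ^ (-g)| ^ (p - 1) ≤ 1 * 1 := by gcongr
    have h7 : 0 ≤ t ^ (-g * p) := by positivity
    linarith
  calc t ^ (-g) * ratioKernel p α β q g t
      = (t ^ (-g) * |1 - t ^ (-g)| ^ (p - 1)) * (t ^ α + t ^ β) * (1 / (1 - t) ^ (1 + q)) := by
        unfold ratioKernel; ring
    _ ≤ _ := by gcongr

theorem lintegral_ratioKernel_lt_top {p α β q g r : ℝ} (hp : 1 < p) (hq : 0 < q)
    (hgp : g * p = 1 + α + β - q) (hα : α ∈ Set.Ioo (-1) q) (hβ : β ∈ Set.Ioo (-1) q)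
    (hg : 0 < g) (hr : r < 1) :
    ∫⁻ t in Set.Ioo 0 r, ENNReal.ofReal (ratioKernel p α β q g t) < ⊤ := by
  refine setLIntegral_ofReal_lt_top_of_le measurableSet_Ioo
    (((integrableOn_rpow_sum hgp hα hβ).mono_set (Set.Ioo_subset_Ioo_right hr.le)).mul_const
      (1 / (1 - r) ^ (1 + q))) fun t ht => ?_
  have ht0 := ht.1
  have h1 : 0 < 1 - t := by linarith [ht.2]
  have h5 := one_div_rpow_one_sub_le hq ht.2 hr
  have h6 : |1 - t ^ (-g)| ^ (p - 1) ≤ 1 + t ^ (-g * p) := by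
    have h7 := abs_one_sub_rpow_le (z := t ^ (-g)) (e := p - 1) (by positivity) (by linarith)
    rw [← Real.rpow_mul ht0.le] at h7
    have h8 : t ^ (-g * (p - 1)) ≤ t ^ (-g * p) :=
      Real.rpow_le_rpow_of_exponent_ge ht0 (by linarith) (by nlinarith)
    linarith
  calc ratioKernel p α β q g t
      = |1 - t ^ (-g)| ^ (p - 1) * (t ^ α + t ^ β) * (1 / (1 - t) ^ (1 + q)) := by
        unfold ratioKernel; ring
    _ ≤ _ := by gcongr

/-- Mean value bound away from 0. It makes the Hardy integrand O((1-t)^(p-1-q)) near 1, which is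
integrable when q < p. -/
theorem exists_abs_one_sub_rpow_le (g : ℝ) :
    ∃ K : ℝ, 0 ≤ K ∧ ∀ t ∈ Set.Icc (1 / 2 : ℝ) 1, |1 - t ^ (-g)| ≤ K * (1 - t) := by
  have hc : ContinuousOn (fun t : ℝ => -g * t ^ (-g - 1)) (Set.Icc (1 / 2) 1) := by
    refine continuousOn_const.mul (continuousOn_id.rpow_const fun t ht => Or.inl ?_)
    have := ht.1
    simp only [id]
    linarith
  obtain ⟨K, hK⟩ := isCompact_Icc.exists_bound_of_continuousOn hc
  refine ⟨K, (norm_nonneg _).trans (hK 1 (by norm_num)), fun t ht => ?_⟩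
  have h := (convex_Icc (1 / 2 : ℝ) 1).norm_image_sub_le_of_norm_hasDerivWithin_le
    (f := fun t : ℝ => t ^ (-g)) (f' := fun t => -g * t ^ (-g - 1)) (C := K)
    (fun x hx => (Real.hasDerivAt_rpow_const (Or.inl (by linarith [hx.1]))).hasDerivWithinAt)
    hK ht (Set.right_mem_Icc.2 (by norm_num))
  rw [Real.one_rpow, Real.norm_eq_abs, Real.norm_eq_abs, abs_of_nonneg (sub_nonneg.2 ht.2)] at h
  exact h

theorem integrableOn_one_sub_rpow {e : ℝ} (he : -1 < e) :
    IntegrableOn (fun t : ℝ => (1 - t) ^ e) (Set.Ioo (1 / 2) 1) := by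
  have h := (intervalIntegral.intervalIntegrable_rpow' he (a := 1 / 2) (b := 0)).comp_sub_left 1
  norm_num at h
  exact ((intervalIntegrable_iff_integrableOn_Ioo_of_le (by norm_num)).1 h)

theorem integrableOn_hardyIntegrand {p α β q g : ℝ} (hp : 1 < p) (hq : 0 < q) (hqp : q < p)
    (hgp : g * p = 1 + α + β - q) (hα : α ∈ Set.Ioo (-1) q) (hβ : β ∈ Set.Ioo (-1) q) :
    IntegrableOn (hardyIntegrand p α β q g) (Set.Ioo 0 1) := by
  have hm : ∀ s : Set ℝ, AEStronglyMeasurable (hardyIntegrand p α β q g) (volume.restrict s) :=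
    fun s => (measurable_hardyIntegrand p α β q g).aestronglyMeasurable
  have hleft : IntegrableOn (hardyIntegrand p α β q g) (Set.Ioc 0 (1 / 2)) := by
    -- The bound on 1/(1-t)^(1+q) asks for t strictly below the cutoff, so a number between 1/2 and
    -- 1 is used.
    refine (((integrableOn_rpow_sum hgp hα hβ).mono_set (t := Set.Ioo 0 1)
      (s := Set.Ioc 0 (1 / 2)) fun t ht => ⟨ht.1, ht.2.trans_lt (by norm_num)⟩).mul_const
      (1 / (1 - 3 / 4) ^ (1 + q))).mono' (hm _) ?_
    filter_upwards [ae_restrict_mem measurableSet_Ioc] with t ht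
    have ht0 := ht.1
    have ht' : t < 3 / 4 := by linarith [ht.2]
    have h1 : 0 < 1 - t := by linarith
    rw [Real.norm_of_nonneg (hardyIntegrand_nonneg p α β q g ⟨ht0, by linarith⟩)]
    have h5 := one_div_rpow_one_sub_le hq ht' (by norm_num)
    have h7 := abs_one_sub_rpow_le (z := t ^ (-g)) (e := p) (by positivity) (by linarith)
    rw [← Real.rpow_mul ht0.le] at h7
    calc hardyIntegrand p α β q g t
        = |1 - t ^ (-g)| ^ p * (t ^ α + t ^ β) * (1 / (1 - t) ^ (1 + q)) := by
          unfold hardyIntegrand; ring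
      _ ≤ _ := by gcongr
  have hright : IntegrableOn (hardyIntegrand p α β q g) (Set.Ioo (1 / 2) 1) := by
    obtain ⟨K, hK0, hK⟩ := exists_abs_one_sub_rpow_le g
    have hc : ContinuousOn (fun t : ℝ => t ^ α + t ^ β) (Set.Icc (1 / 2) 1) := by
      refine ContinuousOn.add ?_ ?_ <;>
      · refine continuousOn_id.rpow_const fun t ht => Or.inl ?_
        have := ht.1
        simp only [id]
        linarith
    obtain ⟨M, hM⟩ := isCompact_Icc.exists_bound_of_continuousOn hc
    refine ((integrableOn_one_sub_rpow (e := p - 1 - q) (by linarith)).const_mul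
      (M * K ^ p)).mono' (hm _) ?_
    filter_upwards [ae_restrict_mem measurableSet_Ioo] with t ht
    have ht0 : 0 < t := by linarith [ht.1]
    have h1 : 0 < 1 - t := by linarith [ht.2]
    rw [Real.norm_of_nonneg (hardyIntegrand_nonneg p α β q g ⟨ht0, ht.2⟩)]
    have h2 := (le_abs_self _).trans (hM t ⟨ht.1.le, ht.2.le⟩)
    have h3 : |1 - t ^ (-g)| ^ p ≤ (K * (1 - t)) ^ p :=
      Real.rpow_le_rpow (abs_nonneg _) (hK t ⟨ht.1.le, ht.2.le⟩) (by linarith)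
    have h4 : (1 - t) ^ (p - 1 - q) = (1 - t) ^ p / (1 - t) ^ (1 + q) := by
      rw [← Real.rpow_sub h1]; ring_nf
    rw [Real.mul_rpow hK0 h1.le] at h3
    have hM0 : 0 ≤ M := (by positivity : 0 ≤ t ^ α + t ^ β).trans h2
    unfold hardyIntegrand
    calc _ ≤ M * (K ^ p * (1 - t) ^ p) / (1 - t) ^ (1 + q) := by gcongr
      _ = _ := by rw [h4]; ring
  have hunion : Set.Ioo (0 : ℝ) 1 = Set.Ioc 0 (1 / 2) ∪ Set.Ioo (1 / 2) 1 :=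
    (Set.Ioc_union_Ioo_eq_Ioo (by norm_num) (by norm_num)).symm
  rw [hunion]
  exact hleft.union hright

theorem setIntegral_hardyIntegrand_pos {p α β q g : ℝ} (hp : 1 < p) (hq : 0 < q) (hqp : q < p)
    (hgp : g * p = 1 + α + β - q) (hα : α ∈ Set.Ioo (-1) q) (hβ : β ∈ Set.Ioo (-1) q)
    (hg : g ≠ 0) : 0 < ∫ t in Set.Ioo 0 1, hardyIntegrand p α β q g t := by
  rw [setIntegral_pos_iff_support_of_nonneg_ae]
  · have : Function.support (hardyIntegrand p α β q g) ∩ Set.Ioo 0 1 = Set.Ioo 0 1 :=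
      Set.inter_eq_right.2 fun t ht => (hardyIntegrand_pos p α β q hg ht).ne'
    rw [this]
    simp
  · filter_upwards [ae_restrict_mem measurableSet_Ioo] with t ht
    exact hardyIntegrand_nonneg p α β q g ht
  · exact integrableOn_hardyIntegrand hp hq hqp hgp hα hβ

theorem hardyConst_succ (n : ℕ) (s p α β : ℝ) :
    hardyConst (n + 1) s p α β = sliceConst n (s * p) *
      ∫ t in Set.Ioo 0 1, hardyIntegrand p α β (s * p) ((1 + α + β - s * p) / p) t := by
  unfold hardyConst sliceConst hardyIntegrand
  push_cast
  rw [add_sub_cancel_right]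

/-! ### Folding double integrals onto cones of pairs -/

section HalfSpace

variable {n : ℕ}

theorem measurableSet_halfSpace : MeasurableSet (halfSpace n) :=
  measurableSet_lt measurable_const measurable_lastCoord

theorem volume_lastCoord_eq (c : ℝ) : volume {y : Space n | lastCoord y = c} = 0 := by
  have hm : MeasurableSet {y : Space n | lastCoord y = c} :=
    measurableSet_eq_fun measurable_lastCoord measurable_const
  rw [← (measurePreserving_attachLast n).measure_preimage hm.nullMeasurableSet]
  have : attachLast n ⁻¹' {y : Space n | lastCoord y = c} = {c} ×ˢ Set.univ := by
    ext w
    simp [lastCoord_attachLast]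
  rw [this, Measure.volume_eq_prod, Measure.prod_prod]
  simp

/-- The pairs of points of the half-space whose last coordinates satisfy `y_d < r x_d`. -/
def pairCone (n : ℕ) (r : ℝ) : Set (Space n × Space n) :=
  {z | 0 < lastCoord z.2 ∧ lastCoord z.2 < r * lastCoord z.1}

theorem measurableSet_pairCone (r : ℝ) : MeasurableSet (pairCone n r) :=
  MeasurableSet.inter
    (measurableSet_lt measurable_const (measurable_lastCoord.comp measurable_snd))
    (measurableSet_lt (measurable_lastCoord.comp measurable_snd)
      ((measurable_lastCoord.comp measurable_fst).const_mul r))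

theorem pairCone.pos {r : ℝ} (hr : 0 < r) {z : Space n × Space n} (hz : z ∈ pairCone n r) :
    0 < lastCoord z.1 ∧ 0 < lastCoord z.2 := by
  have h : 0 < r * lastCoord z.1 := hz.1.trans hz.2
  exact ⟨(pos_iff_pos_of_mul_pos h).1 hr, hz.1⟩

theorem pairCone.lt {r : ℝ} (hr0 : 0 < r) (hr : r ≤ 1) {z : Space n × Space n}
    (hz : z ∈ pairCone n r) : lastCoord z.2 < lastCoord z.1 := by
  have h := pairCone.pos hr0 hz
  have := hz.2
  nlinarith

/-- A double integral over the half-space, folded onto the pairs with `y_d < x_d`. -/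
theorem setLIntegral_halfSpace_fold {F : Space n × Space n → ENNReal} (hF : Measurable F) :
    ∫⁻ x in halfSpace n, ∫⁻ y in halfSpace n, F (x, y)
      = ∫⁻ z in pairCone n 1, (F z + F z.swap) ∂(volume.prod volume) := by
  have hS := measurableSet_pairCone (n := n) 1
  have hS' : MeasurableSet (Prod.swap ⁻¹' pairCone n 1) := measurable_swap hS
  have h1 : ∫⁻ x in halfSpace n, ∫⁻ y in halfSpace n, F (x, y)
      = ∫⁻ z in halfSpace n ×ˢ halfSpace n, F z ∂(volume.prod volume) := by
    rw [← Measure.prod_restrict, lintegral_prod _ hF.aemeasurable]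
  have hnull : (volume.prod volume) {z : Space n × Space n | lastCoord z.2 = lastCoord z.1} = 0 := by
    rw [Measure.measure_prod_null (measurableSet_eq_fun (by fun_prop) (by fun_prop))]
    exact Filter.Eventually.of_forall fun x => volume_lastCoord_eq (lastCoord x)
  -- Pairs at equal heights are null, so the cone and its mirror image fill the product of
  -- half-spaces.
  have hae : (halfSpace n ×ˢ halfSpace n : Set (Space n × Space n))
      =ᵐ[volume.prod volume] (pairCone n 1 ∪ Prod.swap ⁻¹' pairCone n 1 : Set _) := by
    have h2 : ∀ᵐ z ∂(volume.prod volume : Measure (Space n × Space n)),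
        lastCoord z.2 ≠ lastCoord z.1 := by
      rw [ae_iff]; simpa using hnull
    filter_upwards [h2] with z hz
    refine propext ⟨fun h => ?_, fun h => ?_⟩
    · have ha : 0 < lastCoord z.1 := h.1
      have hb : 0 < lastCoord z.2 := h.2
      rcases lt_or_gt_of_ne hz with h | h
      · exact Or.inl ⟨hb, by rwa [one_mul]⟩
      · exact Or.inr ⟨ha, by rwa [one_mul]⟩
    · rcases h with h | h
      · exact pairCone.pos one_pos h
      · exact (pairCone.pos one_pos h).symm
  have hdisj : Disjoint (pairCone n 1) (Prod.swap ⁻¹' pairCone n 1) := by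
    rw [Set.disjoint_left]
    intro z h h'
    exact lt_asymm (pairCone.lt one_pos le_rfl h) (pairCone.lt one_pos le_rfl h')
  have h3 : ∫⁻ z in Prod.swap ⁻¹' pairCone n 1, F z ∂(volume.prod volume)
      = ∫⁻ z in pairCone n 1, F z.swap ∂(volume.prod volume) := by
    have := (Measure.measurePreserving_swap (μ := (volume : Measure (Space n)))
      (ν := (volume : Measure (Space n)))).setLIntegral_comp_preimage hS (hF.comp measurable_swap)
    simpa using this
  rw [h1, setLIntegral_congr hae, lintegral_union hS' hdisj, h3, ← lintegral_add_left hF]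

theorem tendsto_setLIntegral_iUnion_of_monotone {X : Type*} [MeasurableSpace X] {μ : Measure X}
    (f : X → ENNReal) {s : ℕ → Set X} (hs : Monotone s) :
    Filter.Tendsto (fun k => ∫⁻ x in s k, f x ∂μ) Filter.atTop
      (nhds (∫⁻ x in ⋃ k, s k, f x ∂μ)) := by
  rw [setLIntegral_iUnion_of_directed f hs.directed_le]
  exact tendsto_atTop_iSup fun i j hij => lintegral_mono_set (hs hij)

/-- A sequence in `(0, 1)` increasing to `1`. -/
noncomputable def cutoff (k : ℕ) : ℝ := 1 - 1 / ((k : ℝ) + 2)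

/-- The shift by 2 makes the first term 1/2, so that every cone in the sequence has a positive
opening. -/
theorem cutoff_pos (k : ℕ) : 0 < cutoff k := by
  unfold cutoff
  rw [sub_pos, div_lt_one (by positivity)]
  have : (0 : ℝ) ≤ k := by positivity
  linarith

theorem cutoff_lt_one (k : ℕ) : cutoff k < 1 := by
  unfold cutoff
  have : 0 < 1 / ((k : ℝ) + 2) := by positivity
  linarith

theorem cutoff_mono : Monotone cutoff := by
  intro i j hij
  unfold cutoff
  gcongr

theorem exists_lt_cutoff {t : ℝ} (ht : t < 1) : ∃ k, t < cutoff k := by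
  obtain ⟨k, hk⟩ := exists_nat_one_div_lt (sub_pos.2 ht)
  refine ⟨k, ?_⟩
  have : 1 / ((k : ℝ) + 2) ≤ 1 / ((k : ℝ) + 1) := by gcongr; norm_num
  unfold cutoff
  linarith

theorem tendsto_setLIntegral_Ioo_cutoff (f : ℝ → ENNReal) :
    Filter.Tendsto (fun k => ∫⁻ t in Set.Ioo 0 (cutoff k), f t) Filter.atTop
      (nhds (∫⁻ t in Set.Ioo 0 1, f t)) := by
  have h : ⋃ k, Set.Ioo 0 (cutoff k) = Set.Ioo 0 1 := by
    ext t
    simp only [Set.mem_iUnion]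
    refine ⟨fun ⟨k, hk⟩ => ⟨hk.1, hk.2.trans (cutoff_lt_one k)⟩, fun ht => ?_⟩
    obtain ⟨k, hk⟩ := exists_lt_cutoff ht.2
    exact ⟨k, ht.1, hk⟩
  rw [← h]
  exact tendsto_setLIntegral_iUnion_of_monotone f fun i j hij =>
    Set.Ioo_subset_Ioo_right (cutoff_mono hij)

theorem tendsto_setLIntegral_pairCone_cutoff (F : Space n × Space n → ENNReal) :
    Filter.Tendsto (fun k => ∫⁻ z in pairCone n (cutoff k), F z ∂(volume.prod volume)) Filter.atTop
      (nhds (∫⁻ z in pairCone n 1, F z ∂(volume.prod volume))) := by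
  have h : ⋃ k, pairCone n (cutoff k) = pairCone n 1 := by
    ext z
    simp only [Set.mem_iUnion]
    refine ⟨fun ⟨k, hk⟩ => ⟨hk.1, ?_⟩, fun hz => ?_⟩
    · rw [one_mul]
      exact pairCone.lt (cutoff_pos k) (cutoff_lt_one k).le hk
    · have hp := pairCone.pos one_pos hz
      have hlt := pairCone.lt one_pos le_rfl hz
      obtain ⟨k, hk⟩ := exists_lt_cutoff ((div_lt_one hp.1).2 hlt)
      exact ⟨k, hz.1, (div_lt_iff₀ hp.1).1 hk⟩
  rw [← h]
  refine tendsto_setLIntegral_iUnion_of_monotone F fun i j hij z hz => ⟨hz.1, hz.2.trans_le ?_⟩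
  exact mul_le_mul_of_nonneg_right (cutoff_mono hij) (pairCone.pos (cutoff_pos i) hz).1.le

/-! ### Symmetrized energies and ground state potentials -/

/-- The symmetrized weight `(x_d^a y_d^b + x_d^b y_d^a) / |x - y|^N`. -/
noncomputable def pairWeight (N a b : ℝ) (z : Space n × Space n) : ℝ :=
  (lastCoord z.1 ^ a * lastCoord z.2 ^ b + lastCoord z.1 ^ b * lastCoord z.2 ^ a)
    * (1 / ‖z.1 - z.2‖ ^ N)

theorem pairWeight_swap (N a b : ℝ) (z : Space n × Space n) :
    pairWeight N a b z.swap = pairWeight N a b z := by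
  simp only [pairWeight, Prod.fst_swap, Prod.snd_swap]
  rw [norm_sub_rev]
  ring

theorem pairWeight_nonneg (N a b : ℝ) {z : Space n × Space n}
    (hz : 0 < lastCoord z.1 ∧ 0 < lastCoord z.2) : 0 ≤ pairWeight N a b z := by
  have h1 := hz.1
  have h2 := hz.2
  unfold pairWeight
  positivity

@[fun_prop]
theorem measurable_pairWeight (N a b : ℝ) :
    Measurable (pairWeight N a b : Space n × Space n → ℝ) := by
  unfold pairWeight; fun_prop

/-- The symmetrized Gagliardo integrand. -/
noncomputable def pairEnergy (p N a b : ℝ) (w : Space n → ℝ) (z : Space n × Space n) : ℝ :=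
  |w z.1 - w z.2| ^ p * pairWeight N a b z

theorem pairEnergy_swap (p N a b : ℝ) (w : Space n → ℝ) (z : Space n × Space n) :
    pairEnergy p N a b w z.swap = pairEnergy p N a b w z := by
  rw [pairEnergy, pairWeight_swap, Prod.fst_swap, Prod.snd_swap, abs_sub_comm, pairEnergy]

theorem pairEnergy_nonneg (p N a b : ℝ) (w : Space n → ℝ) {z : Space n × Space n}
    (hz : 0 < lastCoord z.1 ∧ 0 < lastCoord z.2) : 0 ≤ pairEnergy p N a b w z :=
  mul_nonneg (by positivity) (pairWeight_nonneg N a b hz)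

theorem measurable_pairEnergy (p N a b : ℝ) {w : Space n → ℝ} (hw : Measurable w) :
    Measurable (pairEnergy p N a b w) := by
  unfold pairEnergy; fun_prop

theorem gagliardoEnergy_eq_setLIntegral_pairCone (s p a b : ℝ) {u : Space n → ℝ}
    (hu : Measurable u) :
    gagliardoEnergy s p a b u = ∫⁻ z in pairCone n 1, ENNReal.ofReal
      (pairEnergy p (((n + 1 : ℕ) : ℝ) + s * p) a b u z) ∂(volume.prod volume) := by
  unfold gagliardoEnergy
  have hF : Measurable fun z : Space n × Space n => ENNReal.ofReal
      (|u z.1 - u z.2| ^ p / ‖z.1 - z.2‖ ^ (((n + 1 : ℕ) : ℝ) + s * p)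
        * lastCoord z.1 ^ a * lastCoord z.2 ^ b) := by fun_prop
  rw [setLIntegral_halfSpace_fold hF]
  refine setLIntegral_congr_fun (measurableSet_pairCone 1) fun z hz => ?_
  obtain ⟨h1, h2⟩ := pairCone.pos one_pos hz
  simp only [Prod.fst_swap, Prod.snd_swap]
  rw [← ENNReal.ofReal_add (by positivity) (by positivity), abs_sub_comm (u z.2),
    norm_sub_rev z.2]
  congr 1
  unfold pairEnergy pairWeight
  ring

/-- The contribution of the first point of a pair to the ground state potential. -/
noncomputable def potentialTerm (p N α β g : ℝ) (w : Space n → ℝ) (z : Space n × Space n) : ℝ :=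
  |lastCoord z.1 ^ (-g) - lastCoord z.2 ^ (-g)| ^ (p - 1) * (lastCoord z.1 ^ (-g) * |w z.1| ^ p)
    * pairWeight N α β z

theorem measurable_potentialTerm (p N α β g : ℝ) {w : Space n → ℝ} (hw : Measurable w) :
    Measurable (potentialTerm p N α β g w) := by
  unfold potentialTerm; fun_prop

/-- The set `A h` of admissible second heights is left free so that one computation serves both
points of a pair. The factor h^(-g) |w|^p = h^(-g+gp) |u|^p meets the homogeneity h^(α+β-q-g(p-1))
of the line integral; the powers of g cancel and the Hardy weight remains. -/
theorem setLIntegral_potentialTerm {p q α β g : ℝ} (hq : 0 < q) {A : ℝ → Set ℝ}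
    (hA : ∀ h, MeasurableSet (A h))
    (hAh : ∀ h, 0 < h → h ∉ A h)
    (hS : MeasurableSet
      {z : Space n × Space n | 0 < lastCoord z.1 ∧ lastCoord z.2 ∈ A (lastCoord z.1)})
    {J : ENNReal}
    (hJ : ∀ h, 0 < h → ∫⁻ ρ in A h, ENNReal.ofReal (lineKernel p α β q g h ρ)
      = ENNReal.ofReal (h ^ (α + β - q - g * (p - 1))) * J)
    {u w : Space n → ℝ} (hum : Measurable u) (hwm : Measurable w)
    (hw : ∀ x, 0 < lastCoord x → |w x| ^ p = lastCoord x ^ (g * p) * |u x| ^ p) :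
    ∫⁻ z in {z : Space n × Space n | 0 < lastCoord z.1 ∧ lastCoord z.2 ∈ A (lastCoord z.1)},
        ENNReal.ofReal (potentialTerm p (((n + 1 : ℕ) : ℝ) + q) α β g w z) ∂(volume.prod volume)
      = ENNReal.ofReal (sliceConst n q) * J *
        ∫⁻ x in halfSpace n, ENNReal.ofReal (|u x| ^ p / lastCoord x ^ (q - α - β)) := by
  have hT := measurable_potentialTerm p (((n + 1 : ℕ) : ℝ) + q) α β g hwm
  rw [← lintegral_indicator hS, lintegral_prod _ ((hT.ennreal_ofReal.indicator hS).aemeasurable),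
    ← lintegral_const_mul _ (by fun_prop), ← lintegral_indicator measurableSet_halfSpace]
  refine lintegral_congr fun x => ?_
  by_cases hx : 0 < lastCoord x
  swap
  · rw [Set.indicator_of_notMem (by exact hx)]
    refine (lintegral_congr fun y => ?_).trans lintegral_zero
    exact Set.indicator_of_notMem (fun h => hx h.1) _
  rw [Set.indicator_of_mem (by exact hx)]
  set h := lastCoord x with hh
  set G : ℝ → ENNReal := (A h).indicator fun ρ => ENNReal.ofReal
    (|h ^ (-g) - ρ ^ (-g)| ^ (p - 1) * (h ^ α * ρ ^ β + h ^ β * ρ ^ α)) with hG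
  have hGm : Measurable G := Measurable.indicator (by fun_prop) (hA h)
  have hf0 : 0 ≤ h ^ (-g) * |w x| ^ p := by positivity
  have e1 : ∀ y : Space n,
      Set.indicator {z : Space n × Space n | 0 < lastCoord z.1 ∧ lastCoord z.2 ∈ A (lastCoord z.1)}
        (fun z => ENNReal.ofReal (potentialTerm p (((n + 1 : ℕ) : ℝ) + q) α β g w z)) (x, y)
      = ENNReal.ofReal (h ^ (-g) * |w x| ^ p) *
        (G (lastCoord y) * ENNReal.ofReal (1 / ‖x - y‖ ^ (((n + 1 : ℕ) : ℝ) + q))) := by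
    intro y
    by_cases hy : lastCoord y ∈ A h
    · rw [Set.indicator_of_mem (by exact ⟨hx, hy⟩), hG, Set.indicator_of_mem hy,
        ← ENNReal.ofReal_mul' (by positivity), ← ENNReal.ofReal_mul hf0]
      simp only [potentialTerm, pairWeight, ← hh]
      congr 1
      ring
    · rw [Set.indicator_of_notMem (fun h => hy h.2), hG, Set.indicator_of_notMem hy]
      simp
  simp only [e1]
  rw [lintegral_const_mul' _ _ ENNReal.ofReal_ne_top, lintegral_lastCoord_mul_kernel hq x hGm
    (Set.indicator_of_notMem (hAh h hx) _), ← hh]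
  have e2 : ∫⁻ ρ, G ρ * ENNReal.ofReal (1 / |h - ρ| ^ (1 + q))
      = ∫⁻ ρ in A h, ENNReal.ofReal (lineKernel p α β q g h ρ) := by
    rw [← lintegral_indicator (hA h)]
    refine lintegral_congr fun ρ => ?_
    by_cases hρ : ρ ∈ A h
    · rw [hG, Set.indicator_of_mem hρ, Set.indicator_of_mem hρ,
        ← ENNReal.ofReal_mul' (by positivity), lineKernel]
    · rw [hG, Set.indicator_of_notMem hρ, Set.indicator_of_notMem hρ, zero_mul]
  rw [e2, hJ h hx]
  have e3 : |u x| ^ p / h ^ (q - α - β)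
      = h ^ (-g) * |w x| ^ p * h ^ (α + β - q - g * (p - 1)) := by
    have e4 : (h ^ (q - α - β))⁻¹ = h ^ (-g) * h ^ (g * p) * h ^ (α + β - q - g * (p - 1)) := by
      rw [← Real.rpow_neg hx.le, ← Real.rpow_add hx, ← Real.rpow_add hx]
      congr 1; ring
    rw [hw x hx, div_eq_mul_inv, e4]
    ring
  rw [e3, ENNReal.ofReal_mul hf0]
  ring

theorem setLIntegral_potentialTerm_fst {p q α β g r : ℝ} (hq : 0 < q)
    (hr0 : 0 < r) (hr : r < 1)
    {u w : Space n → ℝ} (hum : Measurable u) (hwm : Measurable w)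
    (hw : ∀ x, 0 < lastCoord x → |w x| ^ p = lastCoord x ^ (g * p) * |u x| ^ p) :
    ∫⁻ z in pairCone n r, ENNReal.ofReal (potentialTerm p (((n + 1 : ℕ) : ℝ) + q) α β g w z)
        ∂(volume.prod volume)
      = ENNReal.ofReal (sliceConst n q)
        * (∫⁻ t in Set.Ioo 0 r, ENNReal.ofReal (ratioKernel p α β q g t)) *
        ∫⁻ x in halfSpace n, ENNReal.ofReal (|u x| ^ p / lastCoord x ^ (q - α - β)) := by
  have hS : pairCone n r = {z : Space n × Space n |
      0 < lastCoord z.1 ∧ lastCoord z.2 ∈ Set.Ioo 0 (r * lastCoord z.1)} := by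
    ext z
    exact ⟨fun hz => ⟨(pairCone.pos hr0 hz).1, hz⟩, fun hz => hz.2⟩
  have hm := measurableSet_pairCone (n := n) r
  rw [hS] at hm ⊢
  refine setLIntegral_potentialTerm (A := fun h => Set.Ioo 0 (r * h)) hq
    (fun h => measurableSet_Ioo) (fun h hh hmem => ?_) hm
    (fun h hh => setLIntegral_lineKernel_Ioo p α β q g hh hr.le) hum hwm hw
  have := hmem.2
  nlinarith

/-- Seen from the lower point, the cone consists of the heights above h/r, whence the reciprocal
substitution and the factor t^(-g). -/
theorem setLIntegral_potentialTerm_snd {p q α β g r : ℝ} (hq : 0 < q)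
    (hgp : g * p = 1 + α + β - q) (hr0 : 0 < r) (hr : r < 1)
    {u w : Space n → ℝ} (hum : Measurable u) (hwm : Measurable w)
    (hw : ∀ x, 0 < lastCoord x → |w x| ^ p = lastCoord x ^ (g * p) * |u x| ^ p) :
    ∫⁻ z in pairCone n r, ENNReal.ofReal (potentialTerm p (((n + 1 : ℕ) : ℝ) + q) α β g w z.swap)
        ∂(volume.prod volume)
      = ENNReal.ofReal (sliceConst n q)
        * (∫⁻ t in Set.Ioo 0 r, ENNReal.ofReal (t ^ (-g) * ratioKernel p α β q g t)) *
        ∫⁻ x in halfSpace n, ENNReal.ofReal (|u x| ^ p / lastCoord x ^ (q - α - β)) := by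
  have hS : Prod.swap ⁻¹' pairCone n r = {z : Space n × Space n |
      0 < lastCoord z.1 ∧ lastCoord z.2 ∈ Set.Ioi (lastCoord z.1 / r)} := by
    ext z
    refine and_congr Iff.rfl ?_
    rw [Set.mem_Ioi, div_lt_iff₀ hr0, mul_comm]
    rfl
  have hm : MeasurableSet (Prod.swap ⁻¹' pairCone n r) :=
    measurable_swap (measurableSet_pairCone (n := n) r)
  have hT := measurable_potentialTerm p (((n + 1 : ℕ) : ℝ) + q) α β g hwm
  have hswap := (Measure.measurePreserving_swap (μ := (volume : Measure (Space n)))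
      (ν := (volume : Measure (Space n)))).setLIntegral_comp_preimage
      (measurableSet_pairCone (n := n) r) (hT.ennreal_ofReal.comp measurable_swap)
  simp only [Function.comp_apply, Prod.swap_swap] at hswap
  rw [← hswap]
  rw [hS] at hm ⊢
  refine setLIntegral_potentialTerm (A := fun h => Set.Ioi (h / r)) hq
    (fun h => measurableSet_Ioi) (fun h hh hmem => ?_) hm
    (fun h hh => setLIntegral_lineKernel_Ioi hgp hh hr0 hr.le) hum hwm hw
  have := (div_lt_iff₀ hr0).1 hmem
  nlinarith

theorem potentialTerm_nonneg (p N α β g : ℝ) (w : Space n → ℝ) {z : Space n × Space n}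
    (hz : 0 < lastCoord z.1 ∧ 0 < lastCoord z.2) : 0 ≤ potentialTerm p N α β g w z := by
  have h1 := hz.1
  exact mul_nonneg (by positivity) (pairWeight_nonneg N α β hz)

/-- Since gp/2 = (1+α+β-q)/2, the factor (XY)^(p/2) shifts α and β to the exponents of the remainder
energy. -/
theorem pairWeight_remainder {p q α β g : ℝ} (N : ℝ) (hgp : g * p = 1 + α + β - q)
    {z : Space n × Space n} (hz : 0 < lastCoord z.1 ∧ 0 < lastCoord z.2) :
    pairWeight N (-((1 - α + β - q) / 2)) (-((1 + α - β - q) / 2)) z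
      = (lastCoord z.1 ^ (-g) * lastCoord z.2 ^ (-g)) ^ (p / 2) * pairWeight N α β z := by
  obtain ⟨h1, h2⟩ := hz
  have e : ∀ h : ℝ, 0 < h → h ^ (-((1 - α + β - q) / 2)) = (h ^ (-g)) ^ (p / 2) * h ^ α ∧
      h ^ (-((1 + α - β - q) / 2)) = (h ^ (-g)) ^ (p / 2) * h ^ β := by
    intro h hh
    rw [← Real.rpow_mul hh.le, ← Real.rpow_add hh, ← Real.rpow_add hh]
    constructor <;> congr 1 <;> linarith
  unfold pairWeight
  rw [Real.mul_rpow (by positivity) (by positivity), (e _ h1).1, (e _ h1).2, (e _ h2).1,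
    (e _ h2).2]
  ring

theorem eq_rpow_mul_groundTransform (s p α β : ℝ) (u : Space n → ℝ) {x : Space n}
    (hx : 0 < lastCoord x) :
    u x = lastCoord x ^ (-((1 + α + β - s * p) / p)) * groundTransform s p α β u x := by
  rw [groundTransform, ← mul_assoc, ← Real.rpow_add hx, neg_add_cancel, Real.rpow_zero, one_mul]

theorem abs_groundTransform_rpow (s p α β : ℝ) (u : Space n → ℝ) {x : Space n}
    (hx : 0 < lastCoord x) :
    |groundTransform s p α β u x| ^ p
      = lastCoord x ^ ((1 + α + β - s * p) / p * p) * |u x| ^ p := by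
  rw [groundTransform, abs_mul, abs_of_pos (Real.rpow_pos_of_pos hx _),
    Real.mul_rpow (by positivity) (abs_nonneg _), ← Real.rpow_mul hx.le]

theorem potentialTerm_add_le {s p α β : ℝ} (hp : 2 ≤ p) (N : ℝ) (u : Space n → ℝ)
    {z : Space n × Space n} (hz : 0 < lastCoord z.1 ∧ 0 < lastCoord z.2)
    (hlt : lastCoord z.2 ^ (-((1 + α + β - s * p) / p))
      < lastCoord z.1 ^ (-((1 + α + β - s * p) / p))) :
    potentialTerm p N α β ((1 + α + β - s * p) / p) (groundTransform s p α β u) z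
        + remainderConst p * pairEnergy p N (-((1 - α + β - s * p) / 2))
          (-((1 + α - β - s * p) / 2)) (groundTransform s p α β u) z
      ≤ pairEnergy p N α β u z
        + potentialTerm p N α β ((1 + α + β - s * p) / p) (groundTransform s p α β u) z.swap := by
  have hgp : (1 + α + β - s * p) / p * p = 1 + α + β - s * p := div_mul_cancel₀ _ (by linarith)
  have h := mul_le_mul_of_nonneg_right (ground_state_inequality hp
    (Real.rpow_pos_of_pos hz.2 (-((1 + α + β - s * p) / p))) hlt (groundTransform s p α β u z.1)
    (groundTransform s p α β u z.2)) (pairWeight_nonneg N α β hz)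
  rw [← eq_rpow_mul_groundTransform s p α β u hz.1,
    ← eq_rpow_mul_groundTransform s p α β u hz.2] at h
  unfold pairEnergy potentialTerm
  rw [pairWeight_remainder N hgp hz, pairWeight_swap, Prod.fst_swap, Prod.snd_swap,
    abs_sub_comm (lastCoord z.2 ^ _), abs_of_pos (sub_pos.2 hlt)]
  linarith

theorem potentialTerm_add_eq {s α β : ℝ} (N : ℝ) (u : Space n → ℝ)
    {z : Space n × Space n} (hz : 0 < lastCoord z.1 ∧ 0 < lastCoord z.2)
    (hlt : lastCoord z.2 ^ (-((1 + α + β - s * 2) / 2))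
      < lastCoord z.1 ^ (-((1 + α + β - s * 2) / 2))) :
    potentialTerm 2 N α β ((1 + α + β - s * 2) / 2) (groundTransform s 2 α β u) z
        + remainderConst 2 * pairEnergy 2 N (-((1 - α + β - s * 2) / 2))
          (-((1 + α - β - s * 2) / 2)) (groundTransform s 2 α β u) z
      = pairEnergy 2 N α β u z
        + potentialTerm 2 N α β ((1 + α + β - s * 2) / 2) (groundTransform s 2 α β u) z.swap := by
  have hgp : (1 + α + β - s * 2) / 2 * 2 = 1 + α + β - s * 2 := by ring
  have h := congrArg (· * pairWeight N α β z) (ground_state_identity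
    (lastCoord z.1 ^ (-((1 + α + β - s * 2) / 2))) (lastCoord z.2 ^ (-((1 + α + β - s * 2) / 2)))
    (groundTransform s 2 α β u z.1) (groundTransform s 2 α β u z.2))
  rw [← eq_rpow_mul_groundTransform s 2 α β u hz.1,
    ← eq_rpow_mul_groundTransform s 2 α β u hz.2] at h
  unfold pairEnergy potentialTerm
  rw [pairWeight_remainder N hgp hz, pairWeight_swap, Prod.fst_swap, Prod.snd_swap,
    abs_sub_comm (lastCoord z.2 ^ _), abs_of_pos (sub_pos.2 hlt), remainderConst_two]
  linarith

/-! ### Cancelling the potentials and passing to the limit -/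

section Cancellation

variable {X : Type*} [MeasurableSpace X] {μ : Measure X} {S : Set X} {A B E R : X → ℝ}
  {c : ℝ} {D : ENNReal}

/-- Integrate the pointwise inequality, rewrite the integral of `A` as that of `B` plus `D`, and
cancel the integral of `B`, which is legitimate in [0, ∞] because it is finite. -/
theorem add_setLIntegral_le_of_add_le (hS : MeasurableSet S) (hA : Measurable A)
    (hE : Measurable E) (hR : Measurable R) (hc : 0 ≤ c) (hA0 : ∀ z ∈ S, 0 ≤ A z)
    (hB0 : ∀ z ∈ S, 0 ≤ B z) (hE0 : ∀ z ∈ S, 0 ≤ E z) (hR0 : ∀ z ∈ S, 0 ≤ R z)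
    (hle : ∀ z ∈ S, A z + c * R z ≤ E z + B z)
    (hAB : ∫⁻ z in S, ENNReal.ofReal (A z) ∂μ = (∫⁻ z in S, ENNReal.ofReal (B z) ∂μ) + D)
    (hB : ∫⁻ z in S, ENNReal.ofReal (B z) ∂μ ≠ ⊤) :
    D + ENNReal.ofReal c * ∫⁻ z in S, ENNReal.ofReal (R z) ∂μ
      ≤ ∫⁻ z in S, ENNReal.ofReal (E z) ∂μ := by
  refine ENNReal.le_of_add_le_add_left hB ?_
  rw [← add_assoc, ← hAB, ← lintegral_const_mul _ hR.ennreal_ofReal,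
    ← lintegral_add_left hA.ennreal_ofReal, add_comm (∫⁻ z in S, ENNReal.ofReal (B z) ∂μ),
    ← lintegral_add_left hE.ennreal_ofReal]
  refine setLIntegral_mono' hS fun z hz => ?_
  rw [← ENNReal.ofReal_mul hc, ← ENNReal.ofReal_add (hA0 z hz) (mul_nonneg hc (hR0 z hz)),
    ← ENNReal.ofReal_add (hE0 z hz) (hB0 z hz)]
  exact ENNReal.ofReal_le_ofReal (hle z hz)

theorem add_setLIntegral_eq_of_add_eq (hS : MeasurableSet S) (hA : Measurable A)
    (hE : Measurable E) (hR : Measurable R) (hc : 0 ≤ c) (hA0 : ∀ z ∈ S, 0 ≤ A z)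
    (hB0 : ∀ z ∈ S, 0 ≤ B z) (hE0 : ∀ z ∈ S, 0 ≤ E z) (hR0 : ∀ z ∈ S, 0 ≤ R z)
    (heq : ∀ z ∈ S, A z + c * R z = E z + B z)
    (hAB : ∫⁻ z in S, ENNReal.ofReal (A z) ∂μ = (∫⁻ z in S, ENNReal.ofReal (B z) ∂μ) + D)
    (hB : ∫⁻ z in S, ENNReal.ofReal (B z) ∂μ ≠ ⊤) :
    D + ENNReal.ofReal c * ∫⁻ z in S, ENNReal.ofReal (R z) ∂μ
      = ∫⁻ z in S, ENNReal.ofReal (E z) ∂μ := by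
  refine (ENNReal.add_right_inj hB).1 ?_
  rw [← add_assoc, ← hAB, ← lintegral_const_mul _ hR.ennreal_ofReal,
    ← lintegral_add_left hA.ennreal_ofReal, add_comm (∫⁻ z in S, ENNReal.ofReal (B z) ∂μ),
    ← lintegral_add_left hE.ennreal_ofReal]
  refine setLIntegral_congr_fun hS fun z hz => ?_
  rw [← ENNReal.ofReal_mul hc, ← ENNReal.ofReal_add (hA0 z hz) (mul_nonneg hc (hR0 z hz)),
    ← ENNReal.ofReal_add (hE0 z hz) (hB0 z hz), heq z hz]

end Cancellation

@[fun_prop]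
theorem measurable_groundTransform (s p α β : ℝ) {u : Space n → ℝ} (hu : Measurable u) :
    Measurable (groundTransform s p α β u) := by
  unfold groundTransform; fun_prop

/-- The compact support stays away from x_d = 0, so the integrand is bounded there, and it vanishes
elsewhere. -/
theorem hardyTerm_lt_top (s α β : ℝ) {p : ℝ} (hp : 0 < p) {u : Space n → ℝ}
    (hu : IsCcHalfSpace u) : hardyTerm s p α β u < ⊤ := by
  have hK : IsCompact (tsupport u) := hu.hasCompactSupport
  have hV : Continuous (lastCoord : Space n → ℝ) := by unfold lastCoord; fun_prop
  have hc : ContinuousOn (fun x => |u x| ^ p / lastCoord x ^ (s * p - α - β)) (tsupport u) := by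
    refine ContinuousOn.div ?_ ?_ fun x hx => (Real.rpow_pos_of_pos (hu.tsupport_subset hx) _).ne'
    · exact (hu.continuous.abs.rpow_const fun x => Or.inr hp.le).continuousOn
    · exact hV.continuousOn.rpow_const fun x hx => Or.inl (hu.tsupport_subset hx).ne'
  obtain ⟨M, hM⟩ := hK.exists_bound_of_continuousOn hc
  calc hardyTerm s p α β u
      ≤ ∫⁻ x, ENNReal.ofReal (|u x| ^ p / lastCoord x ^ (s * p - α - β)) :=
        setLIntegral_le_lintegral _ _
    _ ≤ ∫⁻ x, (tsupport u).indicator (fun _ => ENNReal.ofReal M) x := by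
        refine lintegral_mono fun x => ?_
        by_cases hx : x ∈ tsupport u
        · rw [Set.indicator_of_mem hx]
          exact ENNReal.ofReal_le_ofReal ((le_abs_self _).trans (hM x hx))
        · rw [Set.indicator_of_notMem hx, image_eq_zero_of_notMem_tsupport hx]
          simp [Real.zero_rpow hp.ne']
    _ = ENNReal.ofReal M * volume (tsupport u) :=
        lintegral_indicator_const hK.measurableSet _
    _ < ⊤ := ENNReal.mul_lt_top ENNReal.ofReal_lt_top hK.measure_lt_top

/-- The two orderings of the ground state values on a cone of pairs, with the corresponding
decomposition of the potential into a finite part and the truncated Hardy constant. -/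
theorem exists_potential_split {s p α β r : ℝ} (hs0 : 0 < s) (hp : 2 ≤ p)
    (hα : α ∈ Set.Ioo (-1) (s * p)) (hβ : β ∈ Set.Ioo (-1) (s * p)) (hne : 1 + α + β ≠ s * p)
    (hr0 : 0 < r) (hr : r < 1) {u : Space n → ℝ} (hu : Measurable u)
    (hH : hardyTerm s p α β u < ⊤) :
    ∃ σ : Space n × Space n → Space n × Space n, (σ = id ∨ σ = Prod.swap) ∧
      (∀ z ∈ pairCone n r, lastCoord (σ z).2 ^ (-((1 + α + β - s * p) / p))
        < lastCoord (σ z).1 ^ (-((1 + α + β - s * p) / p))) ∧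
      ∫⁻ z in pairCone n r, ENNReal.ofReal (potentialTerm p (((n + 1 : ℕ) : ℝ) + s * p) α β
          ((1 + α + β - s * p) / p) (groundTransform s p α β u) (σ z)) ∂(volume.prod volume)
        = (∫⁻ z in pairCone n r, ENNReal.ofReal (potentialTerm p (((n + 1 : ℕ) : ℝ) + s * p) α β
          ((1 + α + β - s * p) / p) (groundTransform s p α β u) (σ z).swap) ∂(volume.prod volume))
          + ENNReal.ofReal (sliceConst n (s * p)) * (∫⁻ t in Set.Ioo 0 r, ENNReal.ofReal
            (hardyIntegrand p α β (s * p) ((1 + α + β - s * p) / p) t)) * hardyTerm s p α β u ∧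
      ∫⁻ z in pairCone n r, ENNReal.ofReal (potentialTerm p (((n + 1 : ℕ) : ℝ) + s * p) α β
          ((1 + α + β - s * p) / p) (groundTransform s p α β u) (σ z).swap)
            ∂(volume.prod volume) ≠ ⊤ := by
  have hq : 0 < s * p := by positivity
  have hgp : (1 + α + β - s * p) / p * p = 1 + α + β - s * p := div_mul_cancel₀ _ (by linarith)
  have hg : (1 + α + β - s * p) / p ≠ 0 := div_ne_zero (sub_ne_zero.2 hne) (by linarith)
  have hw := fun x hx => abs_groundTransform_rpow s p α β u (x := x) hx
  have hwm := measurable_groundTransform s p α β hu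
  have h1 := setLIntegral_potentialTerm_fst (α := α) (β := β) hq hr0 hr hu hwm hw
  have h2 := setLIntegral_potentialTerm_snd hq hgp hr0 hr hu hwm hw
  set g := (1 + α + β - s * p) / p
  change _ = _ * hardyTerm s p α β u at h1 h2
  -- For g < 0 the ground state x_d^(-g) increases with height and the higher point already carries
  -- the larger value; for g > 0 it decreases and the pair must be swapped.
  rcases lt_or_gt_of_ne hg with hg | hg
  · refine ⟨id, Or.inl rfl, fun z hz => ?_, ?_, ?_⟩
    · exact Real.rpow_lt_rpow hz.1.le (pairCone.lt hr0 hr.le hz) (by linarith)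
    · simp only [id]
      rw [h1, h2, lintegral_ratioKernel_of_neg (by linarith) α β (s * p) hg hr.le]
      ring
    · simp only [id]
      rw [h2]
      exact (ENNReal.mul_lt_top (ENNReal.mul_lt_top ENNReal.ofReal_lt_top
        (lintegral_mul_ratioKernel_lt_top (by linarith) hq hgp hα hβ hg hr)) hH).ne
  · refine ⟨Prod.swap, Or.inr rfl, fun z hz => ?_, ?_, ?_⟩
    · exact Real.rpow_lt_rpow_of_neg hz.1 (pairCone.lt hr0 hr.le hz) (by linarith)
    · simp only [Prod.swap_swap]
      rw [h1, h2, lintegral_ratioKernel_of_pos (by linarith) α β (s * p) hg hr.le]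
      ring
    · simp only [Prod.swap_swap]
      rw [h1]
      exact (ENNReal.mul_lt_top (ENNReal.mul_lt_top ENNReal.ofReal_lt_top
        (lintegral_ratioKernel_lt_top (by linarith) hq hgp hα hβ hg hr)) hH).ne

/-- The Hardy inequality with remainder for pairs in a cone, and the identity for `p = 2`. -/
theorem hardy_remainder_pairCone {s p α β r : ℝ} (hs0 : 0 < s) (hp : 2 ≤ p)
    (hα : α ∈ Set.Ioo (-1) (s * p)) (hβ : β ∈ Set.Ioo (-1) (s * p)) (hne : 1 + α + β ≠ s * p)
    (hr0 : 0 < r) (hr : r < 1) {u : Space n → ℝ} (hu : Measurable u)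
    (hH : hardyTerm s p α β u < ⊤) :
    (ENNReal.ofReal (sliceConst n (s * p)) * (∫⁻ t in Set.Ioo 0 r, ENNReal.ofReal
          (hardyIntegrand p α β (s * p) ((1 + α + β - s * p) / p) t)) * hardyTerm s p α β u
        + ENNReal.ofReal (remainderConst p) * ∫⁻ z in pairCone n r, ENNReal.ofReal
          (pairEnergy p (((n + 1 : ℕ) : ℝ) + s * p) (-((1 - α + β - s * p) / 2))
            (-((1 + α - β - s * p) / 2)) (groundTransform s p α β u) z) ∂(volume.prod volume)
      ≤ ∫⁻ z in pairCone n r, ENNReal.ofReal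
          (pairEnergy p (((n + 1 : ℕ) : ℝ) + s * p) α β u z) ∂(volume.prod volume)) ∧
    (p = 2 →
      ENNReal.ofReal (sliceConst n (s * p)) * (∫⁻ t in Set.Ioo 0 r, ENNReal.ofReal
          (hardyIntegrand p α β (s * p) ((1 + α + β - s * p) / p) t)) * hardyTerm s p α β u
        + ENNReal.ofReal (remainderConst p) * ∫⁻ z in pairCone n r, ENNReal.ofReal
          (pairEnergy p (((n + 1 : ℕ) : ℝ) + s * p) (-((1 - α + β - s * p) / 2))
            (-((1 + α - β - s * p) / 2)) (groundTransform s p α β u) z) ∂(volume.prod volume)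
      = ∫⁻ z in pairCone n r, ENNReal.ofReal
          (pairEnergy p (((n + 1 : ℕ) : ℝ) + s * p) α β u z) ∂(volume.prod volume)) := by
  obtain ⟨σ, hσ, hlt, hsplit, hfin⟩ :=
    exists_potential_split hs0 hp hα hβ hne hr0 hr hu hH
  have hwm := measurable_groundTransform s p α β hu
  have hσm : Measurable σ := by
    rcases hσ with rfl | rfl
    · exact measurable_id
    · exact measurable_swap
  have hσpos : ∀ z ∈ pairCone n r, 0 < lastCoord (σ z).1 ∧ 0 < lastCoord (σ z).2 := by
    intro z hz
    rcases hσ with rfl | rfl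
    · exact pairCone.pos hr0 hz
    · exact (pairCone.pos hr0 hz).symm
  have hσE : ∀ (p N a b : ℝ) (w : Space n → ℝ) (z : Space n × Space n),
      pairEnergy p N a b w (σ z) = pairEnergy p N a b w z := by
    intro p N a b w z
    rcases hσ with rfl | rfl
    · rfl
    · exact pairEnergy_swap p N a b w z
  have hS := measurableSet_pairCone (n := n) r
  have hA := (measurable_potentialTerm p (((n + 1 : ℕ) : ℝ) + s * p) α β
    ((1 + α + β - s * p) / p) hwm).comp hσm
  have hE := measurable_pairEnergy p (((n + 1 : ℕ) : ℝ) + s * p) α β hu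
  have hR := measurable_pairEnergy p (((n + 1 : ℕ) : ℝ) + s * p) (-((1 - α + β - s * p) / 2))
    (-((1 + α - β - s * p) / 2)) hwm
  refine ⟨add_setLIntegral_le_of_add_le hS hA hE hR (remainderConst_pos hp).le
    (fun z hz => potentialTerm_nonneg _ _ _ _ _ _ (hσpos z hz))
    (fun z hz => potentialTerm_nonneg _ _ _ _ _ _ (hσpos z hz).symm)
    (fun z hz => pairEnergy_nonneg _ _ _ _ _ (pairCone.pos hr0 hz))
    (fun z hz => pairEnergy_nonneg _ _ _ _ _ (pairCone.pos hr0 hz))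
    (fun z hz => ?_) hsplit hfin, ?_⟩
  · have h := potentialTerm_add_le hp (((n + 1 : ℕ) : ℝ) + s * p) u (hσpos z hz) (hlt z hz)
    rwa [hσE, hσE] at h
  · rintro rfl
    refine add_setLIntegral_eq_of_add_eq hS hA hE hR (remainderConst_pos hp).le
      (fun z hz => potentialTerm_nonneg _ _ _ _ _ _ (hσpos z hz))
      (fun z hz => potentialTerm_nonneg _ _ _ _ _ _ (hσpos z hz).symm)
      (fun z hz => pairEnergy_nonneg _ _ _ _ _ (pairCone.pos hr0 hz))
      (fun z hz => pairEnergy_nonneg _ _ _ _ _ (pairCone.pos hr0 hz))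
      (fun z hz => ?_) hsplit hfin
    have h := potentialTerm_add_eq (((n + 1 : ℕ) : ℝ) + s * 2) u (hσpos z hz) (hlt z hz)
    rwa [hσE, hσE] at h

end HalfSpace

theorem theorem1p2 (s p α β : ℝ) (hs0 : 0 < s) (hs1 : s < 1) (hp : 2 ≤ p)
    (hα : α ∈ Set.Ioo (-1) (s * p)) (hβ : β ∈ Set.Ioo (-1) (s * p))
    (hαβ : α + β ∈ Set.Ioo (-1) (s * p)) (hne : 1 + α + β ≠ s * p) :
    -- `c_p` is a minimum, and `c_2 = 1`
    IsLeast (remainderValues p) (remainderConst p) ∧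
    remainderConst 2 = 1 ∧
    ∀ n : ℕ,
      0 < hardyConst (n + 1) s p α β ∧
      ∀ u : Space n → ℝ, IsCcHalfSpace u →
        -- the Hardy term is finite, so it may be subtracted from the (possibly infinite) energy
        hardyTerm s p α β u < ⊤ ∧
        ENNReal.ofReal (hardyConst (n + 1) s p α β) * hardyTerm s p α β u
            + ENNReal.ofReal (remainderConst p)
              * gagliardoEnergy s p (-((1 - α + β - s * p) / 2)) (-((1 + α - β - s * p) / 2))
                  (groundTransform s p α β u)
          ≤ gagliardoEnergy s p α β u ∧
        (p = 2 →
          gagliardoEnergy s p α β u =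
            ENNReal.ofReal (hardyConst (n + 1) s p α β) * hardyTerm s p α β u
              + gagliardoEnergy s p (-((1 - α + β - s * p) / 2)) (-((1 + α - β - s * p) / 2))
                  (groundTransform s p α β u)) := by
  have hq : 0 < s * p := by positivity
  -- This is where s < 1 enters: it makes the integral in 𝒟 converge at t = 1.
  have hqp : s * p < p := by nlinarith
  have hp1 : 1 < p := by linarith
  have hgp : (1 + α + β - s * p) / p * p = 1 + α + β - s * p := div_mul_cancel₀ _ (by linarith)
  have hg : (1 + α + β - s * p) / p ≠ 0 := div_ne_zero (sub_ne_zero.2 hne) (by linarith)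
  refine ⟨isLeast_remainderConst hp, remainderConst_two, fun n => ⟨?_, fun u hu => ?_⟩⟩
  · rw [hardyConst_succ]
    exact mul_pos (sliceConst_pos n hq) (setIntegral_hardyIntegrand_pos hp1 hq hqp hgp hα hβ hg)
  have hH := hardyTerm_lt_top s α β (by linarith : 0 < p) hu
  have hum : Measurable u := hu.continuous.measurable
  have hwm := measurable_groundTransform s p α β hum
  have hD : ENNReal.ofReal (hardyConst (n + 1) s p α β) = ENNReal.ofReal (sliceConst n (s * p)) *
      ∫⁻ t in Set.Ioo 0 1, ENNReal.ofReal
        (hardyIntegrand p α β (s * p) ((1 + α + β - s * p) / p) t) := by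
    rw [hardyConst_succ, ENNReal.ofReal_mul (sliceConst_pos n hq).le,
      ofReal_integral_eq_lintegral_ofReal (integrableOn_hardyIntegrand hp1 hq hqp hgp hα hβ)]
    filter_upwards [ae_restrict_mem measurableSet_Ioo] with t ht
    exact hardyIntegrand_nonneg _ _ _ _ _ ht
  -- As the cone opens, the truncated constant and the remainder energy increase to their full
  -- values. Products pass to the limit in [0, ∞] because the fixed factors, among them the Hardy
  -- term, are finite.
  have hlim := (ENNReal.Tendsto.mul_const (ENNReal.Tendsto.const_mul
    (tendsto_setLIntegral_Ioo_cutoff (fun t => ENNReal.ofReal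
      (hardyIntegrand p α β (s * p) ((1 + α + β - s * p) / p) t)))
    (Or.inr (ENNReal.ofReal_ne_top (r := sliceConst n (s * p)))))
    (Or.inr hH.ne)).add (ENNReal.Tendsto.const_mul
    (tendsto_setLIntegral_pairCone_cutoff (n := n) fun z => ENNReal.ofReal
      (pairEnergy p (((n + 1 : ℕ) : ℝ) + s * p) (-((1 - α + β - s * p) / 2))
        (-((1 + α - β - s * p) / 2)) (groundTransform s p α β u) z))
    (Or.inr (ENNReal.ofReal_ne_top (r := remainderConst p))))
  have hlimE := tendsto_setLIntegral_pairCone_cutoff (n := n) fun z => ENNReal.ofReal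
      (pairEnergy p (((n + 1 : ℕ) : ℝ) + s * p) α β u z)
  have hk := fun k => hardy_remainder_pairCone hs0 hp hα hβ hne (cutoff_pos k)
    (cutoff_lt_one k) hum hH
  rw [gagliardoEnergy_eq_setLIntegral_pairCone s p α β hum,
    gagliardoEnergy_eq_setLIntegral_pairCone s p _ _ hwm, hD]
  refine ⟨hH, le_of_tendsto_of_tendsto' hlim hlimE fun k => (hk k).1, fun h2 => ?_⟩
  have h := tendsto_nhds_unique (hlim.congr fun k => (hk k).2 h2) hlimE
  subst h2
  rw [← h, remainderConst_two, ENNReal.ofReal_one, one_mul]
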